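/- Equip complex third-order tensors with the T-product $\mathscr A*\mathscr B=\mathrm{fold}(\mathrm{bcirc}(\mathscr A)\,\mathrm{unfold}(\mathscr B))$, where $\mathrm{bcirc}$ is the block-circulant embedding, and with the Frobenius inner product $\langle\mathscr X,\mathscr Y\rangle_F=\sum\overline{x_{ijk}}\,y_{ijk}$. Let $$\mathbb T_+^{n\times n\times p}=\{\mathscr A\in\mathbb C^{n\times n\times p} : \operatorname{Re}\langle\mathscr X,\mathscr A*\mathscr X\rangle_F>0\ \text{ for all } 0\ne\mathscr X\in\mathbb C^{n\times 1\times p}\}.$$ For $\mathscr A\in\mathbb T_+^{n\times n\times p}$, the principal power $\mathscr A^{\alpha}$ ($\alpha$ real) is the tensor whose Fourier slices (frontal slices of the discrete Fourier transform along the third mode) are $\bm A_i^{\alpha}=\frac1{2\pi i}\oint_\Gamma (z\bm I-\bm A_i)^{-1}z^{\alpha}\,dz$, where $\bm A_1,\dots,\bm A_p$ are the Fourier slices of $\mathscr A$, $z^\alpha$ is the principal branch and $\Gamma$ is a circle, traversed once counterclockwise, enclosing the eigenvalues of $\bm A_i$, whose closed disc avoids $(-\infty,0]$. A tensor $\mathscr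 A\in\mathbb C^{n\times n\times p}$ is sectorial if $\langle\mathscr X,\mathscr A*\mathscr X\rangle_F\ne0$ whenever $\|\mathscr X\|_F=1$. A canonical phase vector of a sectorial $\mathscr A$ is a vector $\phi(\mathscr A)=(\phi_1,\dots,\phi_{np})$ with $\phi_k\in(-\pi,\pi]$, $\phi_1\ge\dots\ge\phi_{np}$ and $\phi_1-\phi_{np}<\pi$, such that $\mathrm{bcirc}(\mathscr A)=\bm T^H\bm D\bm T$ for some nonsingular $\bm T$ and some diagonal unitary $\bm D$ whose diagonal entries are, up to order, $e^{j\phi_1},\dots,e^{j\phi_{np}}$. For real vectors of length $N$, $x\prec y$ means that for every $k$ the sum of the $k$ largest entries of $x$ is at most that of $y$, with equality for $k=N$. **Corollary.** Let $\mathscr A\in\mathbb T_+^{n\times n\times p}$. Then $\mathscr A^{1/2}$ is the unique $\mathscr S\in\mathbb T_+^{n\times n\times p}$ with $\mathscr S*\mathscr S=\mathscr A$, both $\mathscr A$ and $\mathscr A^{1/2}$ have exactly one canonical phase vector, and $$2\,\phi(\mathscr A^{1/2})\prec\phi(\mathscr A).$$ -/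

import Mathlib

noncomputable section

namespace TProduct

/-- Third-order complex tensors `m × n × p`, given by their `p` frontal slices. -/
abbrev Tensor (m n p : ℕ) : Type := Fin p → Matrix (Fin m) (Fin n) ℂ

/-- Block-circulant embedding: block `(i, j)` is the frontal slice with index `i - j` modulo `p`. -/
def bcirc {m n p : ℕ} (A : Tensor m n p) : Matrix (Fin p × Fin m) (Fin p × Fin n) ℂ :=
  Matrix.of fun x y => A (x.1 - y.1) x.2 y.2

/-- Stacking the frontal slices into a block column. -/
def unfoldT {m n p : ℕ} (A : Tensor m n p) : Matrix (Fin p × Fin m) (Fin n) ℂ :=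
  Matrix.of fun x j => A x.1 x.2 j

/-- The inverse of `unfoldT`. -/
def foldT {m n p : ℕ} (M : Matrix (Fin p × Fin m) (Fin n) ℂ) : Tensor m n p :=
  fun k => Matrix.of fun i j => M (k, i) j

/-- The T-product. -/
def tMul {m n s p : ℕ} (A : Tensor m n p) (B : Tensor n s p) : Tensor m s p :=
  foldT (bcirc A * unfoldT B)

/-- The Frobenius inner product, conjugate-linear in the first argument. -/
def frobInner {m n p : ℕ} (A B : Tensor m n p) : ℂ :=
  ∑ k, ∑ i, ∑ j, star (A k i j) * B k i j

/-- The Frobenius norm. -/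
def frobNorm {m n p : ℕ} (A : Tensor m n p) : ℝ :=
  Real.sqrt (frobInner A A).re

/-- The numerical range of a frontal-square tensor. -/
def numRange {n p : ℕ} (A : Tensor n n p) : Set ℂ :=
  {w | ∃ X : Tensor n 1 p, frobNorm X = 1 ∧ w = frobInner X (tMul A X)}

/-- A tensor is sectorial if `0` is not in its numerical range. -/
def IsSectorial {n p : ℕ} (A : Tensor n n p) : Prop := (0 : ℂ) ∉ numRange A

/-- The strictly accretive tensors. -/
def accretive (n p : ℕ) : Set (Tensor n n p) :=
  {A | ∀ X : Tensor n 1 p, X ≠ 0 → 0 < (frobInner X (tMul A X)).re}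

/-- `φ` is a canonical T-phase vector of the sectorial tensor `A`: a nonincreasing vector with
entries in `(-π, π]` and spread less than `π`, whose exponentials `e^{iφ_k}` are, in some order,
the diagonal entries of `D` in a sectorial decomposition `bcirc A = Tᴴ D T`, `T` nonsingular. -/
structure IsCanonicalPhaseVector {n p : ℕ} (A : Tensor n n p) (φ : Fin (n * p) → ℝ) : Prop where
  sectorial : IsSectorial A
  antitone : Antitone φ
  mem_Ioc : ∀ k, φ k ∈ Set.Ioc (-Real.pi) Real.pi
  spread : ∀ k l, φ k - φ l < Real.pi
  decomposition : ∃ (T : Matrix (Fin p × Fin n) (Fin p × Fin n) ℂ)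
    (e : Fin p × Fin n ≃ Fin (n * p)), IsUnit T ∧
      bcirc A = T.conjTranspose *
        Matrix.diagonal (fun x => Complex.exp ((φ (e x) : ℂ) * Complex.I)) * T

open Classical in
/-- The canonical T-phase vector (the zero vector if there is none). -/
def phases {n p : ℕ} (A : Tensor n n p) : Fin (n * p) → ℝ :=
  if h : ∃ φ, IsCanonicalPhaseVector A φ then h.choose else 0

/-- The frontal slices of the discrete Fourier transform of `A` along the third mode. -/
def fourierSlice {m n p : ℕ} (A : Tensor m n p) (i : Fin p) : Matrix (Fin m) (Fin n) ℂ :=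
  ∑ k : Fin p, Complex.exp (-(2 * Real.pi * Complex.I * (i : ℕ) * (k : ℕ) / p)) • A k

/-- The tensor whose Fourier slices are the given matrices (inverse discrete Fourier transform). -/
def ofFourierSlices {m n p : ℕ} (M : Fin p → Matrix (Fin m) (Fin n) ℂ) : Tensor m n p :=
  fun k => (p : ℂ)⁻¹ •
    ∑ i : Fin p, Complex.exp (2 * Real.pi * Complex.I * (i : ℕ) * (k : ℕ) / p) • M i

/-- The circle with centre `c` and radius `r`, run through once counterclockwise, encloses every
eigenvalue of `M`, and its closed disc avoids the branch cut `(-∞, 0]`. -/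
def IsContour {n : ℕ} (M : Matrix (Fin n) (Fin n) ℂ) (c : ℂ) (r : ℝ) : Prop :=
  0 < r ∧ Metric.closedBall c r ⊆ Complex.slitPlane ∧ spectrum ℂ M ⊆ Metric.ball c r

/-- The Dunford–Taylor integral `(2πi)⁻¹ ∮ (z - M)⁻¹ z^α dz` over a circle, entrywise; `z ^ α` is
the principal power. -/
def dunfordTaylor {n : ℕ} (M : Matrix (Fin n) (Fin n) ℂ) (α : ℝ) (c : ℂ) (r : ℝ) :
    Matrix (Fin n) (Fin n) ℂ :=
  Matrix.of fun a b => (2 * Real.pi * Complex.I)⁻¹ *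
    ∮ z in C(c, r), ((z • (1 : Matrix (Fin n) (Fin n) ℂ) - M)⁻¹ a b) * z ^ (α : ℂ)

open Classical in
/-- The principal power `M ^ α`, by the Dunford–Taylor integral over any admissible circle (the
value does not depend on the circle by Cauchy's theorem). An admissible circle exists whenever all
eigenvalues of `M` have positive real part. -/
def matPow {n : ℕ} (M : Matrix (Fin n) (Fin n) ℂ) (α : ℝ) : Matrix (Fin n) (Fin n) ℂ :=
  if h : ∃ q : ℂ × ℝ, IsContour M q.1 q.2 then dunfordTaylor M α h.choose.1 h.choose.2 else 0

/-- The principal power of a tensor: principal powers of the Fourier slices. -/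
def tPow {n p : ℕ} (A : Tensor n n p) (α : ℝ) : Tensor n n p :=
  ofFourierSlices fun i => matPow (fourierSlice A i) α

/-- The nonincreasing rearrangement of a real vector. -/
def decreasing {N : ℕ} (x : Fin N → ℝ) : Fin N → ℝ :=
  fun i => x (Tuple.sort x i.rev)

/-- (Strong) majorization `x ≺ y`. -/
def Majorized {N : ℕ} (x y : Fin N → ℝ) : Prop :=
  (∀ k : ℕ, ∑ i with i.val < k, decreasing x i ≤ ∑ i with i.val < k, decreasing y i) ∧
    ∑ i, x i = ∑ i, y i

end TProduct

end

noncomputable section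

namespace TProduct

open Matrix
open scoped ComplexOrder

/-- A square complex matrix is strictly accretive if its Hermitian part is positive definite. -/
def StrictlyAccretive {ι : Type*} [Fintype ι] (M : Matrix ι ι ℂ) : Prop :=
  ∀ x : ι → ℂ, x ≠ 0 → 0 < (star x ⬝ᵥ M *ᵥ x).re

/-- The diagonal unitary matrix with the given angles. -/
def phaseDiag {ι : Type*} [DecidableEq ι] (φ : ι → ℝ) : Matrix ι ι ℂ :=
  diagonal fun k => Complex.exp ((φ k : ℂ) * Complex.I)

/-- `φ` lists, in nonincreasing order, the angles of a sectorial decomposition `M = Tᴴ D T` of a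
strictly accretive matrix. -/
structure IsPhaseVector {ι : Type*} [Fintype ι] [DecidableEq ι] {N : ℕ} (M : Matrix ι ι ℂ)
    (φ : Fin N → ℝ) : Prop where
  antitone : Antitone φ
  mem_Ioo : ∀ k, φ k ∈ Set.Ioo (-(Real.pi / 2)) (Real.pi / 2)
  decomposition : ∃ (T : Matrix (Fin N) ι ℂ) (R : Matrix ι (Fin N) ℂ), T * R = 1 ∧ R * T = 1 ∧
    M = Tᴴ * phaseDiag φ * T

section Quadratic

variable {ι κ : Type*} [Fintype ι] [Fintype κ]

theorem star_dotProduct_congruence (X : Matrix ι κ ℂ) (M : Matrix ι ι ℂ) (x : κ → ℂ) :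
    star x ⬝ᵥ (Xᴴ * M * X) *ᵥ x = star (X *ᵥ x) ⬝ᵥ M *ᵥ (X *ᵥ x) := by
  rw [star_mulVec, ← dotProduct_mulVec, mulVec_mulVec, mulVec_mulVec, Matrix.mul_assoc]

theorem star_dotProduct_phaseDiag [DecidableEq ι] (φ : ι → ℝ) (x : ι → ℂ) :
    star x ⬝ᵥ phaseDiag φ *ᵥ x =
      ∑ k, (Complex.normSq (x k) : ℂ) * Complex.exp ((φ k : ℂ) * Complex.I) := by
  simp only [phaseDiag, dotProduct, mulVec_diagonal, Pi.star_apply]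
  refine Finset.sum_congr rfl fun k _ => ?_
  rw [Complex.normSq_eq_conj_mul_self]
  simp only [RCLike.star_def]
  ring

theorem star_dotProduct_conjTranspose (M : Matrix ι ι ℂ) (x : ι → ℂ) :
    star x ⬝ᵥ Mᴴ *ᵥ x = star (star x ⬝ᵥ M *ᵥ x) := by
  rw [← star_dotProduct_star, star_star, star_mulVec, dotProduct_mulVec, dotProduct_comm]

theorem StrictlyAccretive.congruence {M : Matrix ι ι ℂ} (hM : StrictlyAccretive M)
    {X : Matrix ι κ ℂ} (hX : ∀ x, X *ᵥ x = 0 → x = 0) : StrictlyAccretive (Xᴴ * M * X) := by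
  intro x hx
  rw [star_dotProduct_congruence]
  exact hM _ fun h => hx (hX x h)

theorem StrictlyAccretive.conjTranspose {M : Matrix ι ι ℂ} (hM : StrictlyAccretive M) :
    StrictlyAccretive Mᴴ := by
  intro x hx
  rw [star_dotProduct_conjTranspose]
  simpa using hM x hx

theorem strictlyAccretive_phaseDiag [DecidableEq ι] {φ : ι → ℝ}
    (hφ : ∀ k, φ k ∈ Set.Ioo (-(Real.pi / 2)) (Real.pi / 2)) :
    StrictlyAccretive (phaseDiag φ) := by
  intro x hx
  rw [star_dotProduct_phaseDiag, Complex.re_sum]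
  obtain ⟨k, hk⟩ := Function.ne_iff.1 hx
  refine Finset.sum_pos' (fun l _ => ?_) ⟨k, Finset.mem_univ _, ?_⟩
  · rw [Complex.re_ofReal_mul, Complex.exp_ofReal_mul_I_re]
    exact mul_nonneg (Complex.normSq_nonneg _) (Real.cos_pos_of_mem_Ioo (hφ l)).le
  · rw [Complex.re_ofReal_mul, Complex.exp_ofReal_mul_I_re]
    exact mul_pos (Complex.normSq_pos.2 hk) (Real.cos_pos_of_mem_Ioo (hφ k))

theorem IsPhaseVector.strictlyAccretive [DecidableEq ι] {N : ℕ} {M : Matrix ι ι ℂ}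
    {φ : Fin N → ℝ} (h : IsPhaseVector M φ) : StrictlyAccretive M := by
  obtain ⟨T, R, -, hRT, rfl⟩ := h.decomposition
  refine (strictlyAccretive_phaseDiag h.mem_Ioo).congruence fun x hx => ?_
  rw [← one_mulVec x, ← hRT, ← mulVec_mulVec, hx, mulVec_zero]

theorem mulVec_eq_zero_of_leftInverse [DecidableEq κ] {X : Matrix ι κ ℂ} {Y : Matrix κ ι ℂ}
    (h : Y * X = 1) (x : κ → ℂ) (hx : X *ᵥ x = 0) : x = 0 := by
  rw [← one_mulVec x, ← h, ← mulVec_mulVec, hx, mulVec_zero]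

end Quadratic

section Existence

variable {ι : Type*} [Fintype ι] [DecidableEq ι]

theorem exists_quarter_scaling (t : ℝ) :
    ∃ s : ℝ, 0 < s ∧
      (s : ℂ) * Complex.exp ((Real.arctan t : ℂ) * Complex.I) * s = 1 + t * Complex.I := by
  have h1 : (0 : ℝ) < 1 + t ^ 2 := by positivity
  have h2 : 0 < √(1 + t ^ 2) := Real.sqrt_pos.2 h1
  refine ⟨√√(1 + t ^ 2), Real.sqrt_pos.2 h2, ?_⟩
  rw [mul_right_comm, ← Complex.ofReal_mul, Real.mul_self_sqrt h2.le]
  apply Complex.ext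
  · rw [Complex.re_ofReal_mul, Complex.exp_ofReal_mul_I_re, Real.cos_arctan]
    simp [h2.ne']
  · rw [Complex.im_ofReal_mul, Complex.exp_ofReal_mul_I_im, Real.sin_arctan]
    simp [mul_div_cancel₀ _ h2.ne']

open scoped MatrixOrder Matrix.Norms.L2Operator in
theorem exists_isUnit_conjTranspose_mul_self {H : Matrix ι ι ℂ} (hH : H.PosDef) :
    ∃ R : Matrix ι ι ℂ, IsUnit R ∧ H = Rᴴ * R :=
  CStarAlgebra.isStrictlyPositive_iff_eq_star_mul_self.mp hH.isStrictlyPositive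

omit [DecidableEq ι] in
theorem exists_equiv_antitone {N : ℕ} (hN : Fintype.card ι = N) (θ : ι → ℝ) :
    ∃ e : ι ≃ Fin N, Antitone (θ ∘ e.symm) := by
  let e₀ : ι ≃ Fin N := Fintype.equivFinOfCardEq hN
  let f : Fin N → ℝ := θ ∘ e₀.symm
  refine ⟨e₀.trans ((Fin.revPerm.trans (Tuple.sort f)).symm), fun i j hij => ?_⟩
  exact Tuple.monotone_sort f (Fin.rev_le_rev.2 hij)

theorem StrictlyAccretive.exists_diagonalization {M : Matrix ι ι ℂ} (hM : StrictlyAccretive M) :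
    ∃ (T : Matrix ι ι ℂ) (θ : ι → ℝ), IsUnit T ∧
      (∀ k, θ k ∈ Set.Ioo (-(Real.pi / 2)) (Real.pi / 2)) ∧ M = Tᴴ * phaseDiag θ * T := by
  set H : Matrix ι ι ℂ := (1 / 2 : ℂ) • (M + Mᴴ) with hHdef
  set K : Matrix ι ι ℂ := (-Complex.I / 2) • (M - Mᴴ) with hKdef
  have hMHK : M = H + Complex.I • K := by
    rw [hHdef, hKdef, smul_smul]
    have : Complex.I * (-Complex.I / 2) = 1 / 2 := by
      linear_combination (-1 / 2 : ℂ) * Complex.I_sq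
    rw [this, ← smul_add]
    ext i j
    simp
    ring
  have hH : H.PosDef := by
    refine PosDef.of_dotProduct_mulVec_pos ?_ fun x hx => ?_
    · rw [IsHermitian, hHdef, conjTranspose_smul, conjTranspose_add, conjTranspose_conjTranspose,
        add_comm]
      simp
    · have h := hM x hx
      rw [hHdef, smul_mulVec, add_mulVec, dotProduct_smul, dotProduct_add,
        star_dotProduct_conjTranspose, RCLike.star_def, Complex.add_conj, smul_eq_mul]
      have : (1 / 2 : ℂ) * ((2 * (star x ⬝ᵥ M *ᵥ x).re : ℝ) : ℂ)
          = ((star x ⬝ᵥ M *ᵥ x).re : ℂ) := by push_cast; ring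
      rw [this]
      exact_mod_cast h
  have hK : K.IsHermitian := by
    rw [IsHermitian, hKdef, conjTranspose_smul, conjTranspose_sub, conjTranspose_conjTranspose]
    ext i j
    simp
    ring
  obtain ⟨R, hRu, hR⟩ := exists_isUnit_conjTranspose_mul_self hH
  have hdet := (isUnit_iff_isUnit_det R).1 hRu
  have hRi : R * R⁻¹ = 1 := mul_nonsing_inv R hdet
  have hiR : R⁻¹ * R = 1 := nonsing_inv_mul R hdet
  set L := (R⁻¹)ᴴ * K * R⁻¹ with hLdef
  have hL : L.IsHermitian := by
    rw [IsHermitian, hLdef, conjTranspose_mul, conjTranspose_mul, conjTranspose_conjTranspose,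
      hK.eq, Matrix.mul_assoc]
  have hKL : K = Rᴴ * L * R := by
    have h1 : Rᴴ * (R⁻¹)ᴴ = 1 := by rw [← conjTranspose_mul, hiR, conjTranspose_one]
    calc K = (Rᴴ * (R⁻¹)ᴴ) * K * (R⁻¹ * R) := by rw [h1, hiR, Matrix.one_mul, Matrix.mul_one]
      _ = Rᴴ * L * R := by rw [hLdef]; simp only [Matrix.mul_assoc]
  set V : Matrix ι ι ℂ := (hL.eigenvectorUnitary : Matrix ι ι ℂ) with hV
  have hVV : V * Vᴴ = 1 := Unitary.coe_mul_star_self hL.eigenvectorUnitary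
  have hVV' : Vᴴ * V = 1 := Unitary.coe_star_mul_self hL.eigenvectorUnitary
  have hLV : L = V * diagonal (fun i => (hL.eigenvalues i : ℂ)) * Vᴴ := hL.spectral_theorem
  choose s hs0 hs using fun i => exists_quarter_scaling (hL.eigenvalues i)
  refine ⟨diagonal (fun i => (s i : ℂ)) * Vᴴ * R, fun i => Real.arctan (hL.eigenvalues i),
    ?_, fun k => Real.arctan_mem_Ioo _, ?_⟩
  · refine (IsUnit.mul ?_ ?_).mul hRu
    · rw [isUnit_iff_isUnit_det, det_diagonal, isUnit_iff_ne_zero]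
      exact Finset.prod_ne_zero_iff.2 fun i _ => Complex.ofReal_ne_zero.2 (hs0 i).ne'
    · exact IsUnit.of_mul_eq_one _ hVV'
  · have hsD : (diagonal (fun i => (s i : ℂ)))ᴴ = diagonal (fun i => (s i : ℂ)) := by
      rw [diagonal_conjTranspose]
      congr 1
      ext i
      simp
    have hmid : diagonal (fun i => (s i : ℂ)) *
        phaseDiag (fun i => Real.arctan (hL.eigenvalues i)) * diagonal (fun i => (s i : ℂ)) =
        1 + Complex.I • diagonal (fun i => (hL.eigenvalues i : ℂ)) := by
      rw [phaseDiag, diagonal_mul_diagonal, diagonal_mul_diagonal, ← diagonal_one,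
        ← diagonal_smul, diagonal_add]
      congr 1
      ext i
      rw [hs]
      simp [mul_comm]
    calc M = Rᴴ * (V * (1 + Complex.I • diagonal (fun i => (hL.eigenvalues i : ℂ))) * Vᴴ) * R := by
          rw [Matrix.mul_add, Matrix.add_mul, Matrix.mul_one, hVV, Matrix.mul_smul,
            Matrix.smul_mul, ← hLV, Matrix.mul_add, Matrix.add_mul, Matrix.mul_one, ← hR,
            Matrix.mul_smul, Matrix.smul_mul, ← hKL]
          exact hMHK
      _ = _ := by
          rw [← hmid, conjTranspose_mul, conjTranspose_mul, hsD, conjTranspose_conjTranspose]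
          simp only [Matrix.mul_assoc]

theorem phaseDiag_comp_equiv {κ : Type*} [Fintype κ] [DecidableEq κ] (e : ι ≃ κ) (θ : ι → ℝ)
    (T : Matrix ι ι ℂ) :
    (T.submatrix e.symm id)ᴴ * phaseDiag (θ ∘ e.symm) * T.submatrix e.symm id =
      Tᴴ * phaseDiag θ * T := by
  have : phaseDiag (θ ∘ e.symm) = (phaseDiag θ).submatrix e.symm e.symm := by
    rw [phaseDiag, phaseDiag, submatrix_diagonal_equiv]
    rfl
  rw [this, conjTranspose_submatrix, submatrix_mul_equiv, submatrix_mul_equiv]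
  rfl

theorem StrictlyAccretive.exists_isPhaseVector {M : Matrix ι ι ℂ} (hM : StrictlyAccretive M)
    {N : ℕ} (hN : Fintype.card ι = N) : ∃ φ : Fin N → ℝ, IsPhaseVector M φ := by
  obtain ⟨T, θ, hT, hθ, h⟩ := hM.exists_diagonalization
  obtain ⟨e, he⟩ := exists_equiv_antitone hN θ
  have hdet := (isUnit_iff_isUnit_det T).1 hT
  refine ⟨θ ∘ e.symm, he, fun k => hθ _, T.submatrix e.symm id, T⁻¹.submatrix id e.symm, ?_, ?_,
    ?_⟩
  · rw [← submatrix_mul _ _ _ _ _ Function.bijective_id, mul_nonsing_inv T hdet,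
      submatrix_one_equiv]
  · rw [submatrix_mul_equiv, nonsing_inv_mul T hdet, submatrix_id_id]
  · rw [phaseDiag_comp_equiv, h]

end Existence

section Interlacing

theorem exists_vector_supported {N k : ℕ} (Z : Matrix (Fin N) (Fin k) ℂ) {j : Fin k}
    {i : Fin N} (hij : i.val = j.val) :
    ∃ c : Fin k → ℂ, c ≠ 0 ∧ (∀ l, j < l → c l = 0) ∧ ∀ m, m < i → (Z *ᵥ c) m = 0 := by
  let f : (Fin k → ℂ) →ₗ[ℂ] ({l : Fin k // j < l} → ℂ) × ({m : Fin N // m < i} → ℂ) :=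
    (LinearMap.funLeft ℂ ℂ Subtype.val).prod ((LinearMap.funLeft ℂ ℂ Subtype.val).comp Z.mulVecLin)
  have hker : LinearMap.ker f ≠ ⊥ := by
    apply LinearMap.ker_ne_bot_of_finrank_lt
    simp only [Module.finrank_prod, Module.finrank_fintype_fun_eq_card, Fintype.card_fin,
      Fintype.card_subtype]
    have h1 : (Finset.univ.filter fun l : Fin k => j < l).card = k - 1 - j := by
      rw [← Fin.card_Ioi]; congr 1; ext; simp
    have h2 : (Finset.univ.filter fun l : Fin N => l < i).card = i := by
      rw [← Fin.card_Iio]; congr 1; ext; simp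
    have := j.isLt
    omega
  obtain ⟨c, hc, hc0⟩ := Submodule.exists_mem_ne_zero_of_ne_bot hker
  rw [LinearMap.mem_ker] at hc
  refine ⟨c, hc0, fun l hl => ?_, fun m hm => ?_⟩
  · exact congrFun (congrArg Prod.fst hc) ⟨l, hl⟩
  · exact congrFun (congrArg Prod.snd hc) ⟨m, hm⟩

theorem phase_le_of_congruence {N k : ℕ} {φ : Fin N → ℝ} {θ : Fin k → ℝ} (hφ : Antitone φ)
    (hθ : Antitone θ) (hφm : ∀ k, φ k ∈ Set.Ioo (-(Real.pi / 2)) (Real.pi / 2))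
    (hθm : ∀ k, θ k ∈ Set.Ioo (-(Real.pi / 2)) (Real.pi / 2)) {Z : Matrix (Fin N) (Fin k) ℂ}
    (hZ : Zᴴ * phaseDiag φ * Z = phaseDiag θ) {j : Fin k} {i : Fin N} (hij : i.val = j.val) :
    θ j ≤ φ i := by
  by_contra! hlt
  obtain ⟨c, hc0, hcl, hcm⟩ := exists_vector_supported Z hij
  set d := Z *ᵥ c
  have key : star c ⬝ᵥ phaseDiag θ *ᵥ c = star d ⬝ᵥ phaseDiag φ *ᵥ d := by
    rw [← hZ, star_dotProduct_congruence]
  have hpos := strictlyAccretive_phaseDiag hθm c hc0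
  have hd : d ≠ 0 := by
    intro h
    rw [key, h] at hpos
    simp at hpos
  have rot : ∀ {n : ℕ} (x : Fin n → ℂ) (ψ : Fin n → ℝ),
      (Complex.exp (((-θ j : ℝ) : ℂ) * Complex.I) * (star x ⬝ᵥ phaseDiag ψ *ᵥ x)).im
        = ∑ l, Complex.normSq (x l) * Real.sin (ψ l - θ j) := by
    intro n x ψ
    rw [star_dotProduct_phaseDiag, Finset.mul_sum, Complex.im_sum]
    refine Finset.sum_congr rfl fun l _ => ?_
    rw [mul_left_comm, ← Complex.exp_add, Complex.im_ofReal_mul, ← add_mul, ← Complex.ofReal_add,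
      Complex.exp_ofReal_mul_I_im, neg_add_eq_sub]
  have hsum : ∑ l, Complex.normSq (c l) * Real.sin (θ l - θ j) =
      ∑ m, Complex.normSq (d m) * Real.sin (φ m - θ j) := by
    rw [← rot, ← rot, key]
  have hL : 0 ≤ ∑ l, Complex.normSq (c l) * Real.sin (θ l - θ j) := by
    refine Finset.sum_nonneg fun l _ => ?_
    rcases lt_or_ge j l with h | h
    · simp [hcl l h]
    · refine mul_nonneg (Complex.normSq_nonneg _) (Real.sin_nonneg_of_nonneg_of_le_pi ?_ ?_)
      · linarith [hθ h]
      · linarith [(hθm l).2, (hθm j).1]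
  have hneg : ∀ m, i ≤ m → Real.sin (φ m - θ j) < 0 := fun m hm => by
    apply Real.sin_neg_of_neg_of_neg_pi_lt
    · linarith [hφ hm]
    · linarith [(hφm m).1, (hθm j).2]
  obtain ⟨m, hm⟩ := Function.ne_iff.1 hd
  have hR : ∑ m, Complex.normSq (d m) * Real.sin (φ m - θ j) < 0 := by
    refine Finset.sum_neg' (fun l _ => ?_) ⟨m, Finset.mem_univ _, ?_⟩
    · rcases lt_or_ge l i with h | h
      · simp [d, hcm l h]
      · exact mul_nonpos_of_nonneg_of_nonpos (Complex.normSq_nonneg _) (hneg l h).le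
    · have : i ≤ m := le_of_not_gt fun h => hm (hcm m h)
      exact mul_neg_of_pos_of_neg (Complex.normSq_pos.2 hm) (hneg m this)
  linarith

variable {ι κ : Type*} [Fintype ι] [DecidableEq ι] [Fintype κ] [DecidableEq κ]

theorem IsPhaseVector.le_of_compression {N k : ℕ} {M : Matrix ι ι ℂ} {φ : Fin N → ℝ}
    (hφ : IsPhaseVector M φ) {X : Matrix ι κ ℂ} {θ : Fin k → ℝ}
    (hθ : IsPhaseVector (Xᴴ * M * X) θ) {j : Fin k} {i : Fin N} (hij : i.val = j.val) :
    θ j ≤ φ i := by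
  obtain ⟨T, R, hTR, hRT, hM⟩ := hφ.decomposition
  obtain ⟨U, V, hUV, hVU, hXM⟩ := hθ.decomposition
  refine phase_le_of_congruence (Z := T * X * V) hφ.antitone hθ.antitone hφ.mem_Ioo hθ.mem_Ioo
    ?_ hij
  have h : Vᴴ * (Xᴴ * M * X) * V = phaseDiag θ := by
    rw [hXM]
    calc Vᴴ * (Uᴴ * phaseDiag θ * U) * V = (Vᴴ * Uᴴ) * phaseDiag θ * (U * V) := by
          simp only [Matrix.mul_assoc]
      _ = _ := by rw [← conjTranspose_mul, hUV]; simp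
  rw [← h, hM, conjTranspose_mul, conjTranspose_mul]
  simp only [Matrix.mul_assoc]

theorem IsPhaseVector.unique {N : ℕ} {M : Matrix ι ι ℂ} {φ θ : Fin N → ℝ}
    (hφ : IsPhaseVector M φ) (hθ : IsPhaseVector M θ) : φ = θ := by
  have h : M = (1 : Matrix ι ι ℂ)ᴴ * M * 1 := by simp
  funext j
  refine le_antisymm (hθ.le_of_compression (X := (1 : Matrix ι ι ℂ)) (θ := φ) ?_ rfl)
    (hφ.le_of_compression (X := (1 : Matrix ι ι ℂ)) (θ := θ) ?_ rfl)
  · rwa [← h]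
  · rwa [← h]

theorem IsPhaseVector.conjTranspose {N : ℕ} {M : Matrix ι ι ℂ} {φ : Fin N → ℝ}
    (hφ : IsPhaseVector M φ) : IsPhaseVector Mᴴ (fun k => -φ k.rev) := by
  obtain ⟨T, R, hTR, hRT, hM⟩ := hφ.decomposition
  refine ⟨fun i j hij => neg_le_neg (hφ.antitone (Fin.rev_le_rev.2 hij)), fun k => ?_,
    T.submatrix Fin.revPerm id, R.submatrix id Fin.revPerm, ?_, ?_, ?_⟩
  · have := hφ.mem_Ioo k.rev
    exact ⟨by linarith [this.2], by linarith [this.1]⟩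
  · rw [← submatrix_mul _ _ _ _ _ Function.bijective_id, hTR, submatrix_one_equiv]
  · rw [submatrix_mul_equiv, hRT, submatrix_id_id]
  · have : phaseDiag (fun k => -φ k.rev) = (phaseDiag φ)ᴴ.submatrix Fin.revPerm Fin.revPerm := by
      rw [phaseDiag, phaseDiag, diagonal_conjTranspose, submatrix_diagonal_equiv]
      congr 1
      ext k
      simp only [Function.comp, Pi.star_apply, RCLike.star_def, ← Complex.exp_conj]
      simp
    rw [this, conjTranspose_submatrix, submatrix_mul_equiv, submatrix_mul_equiv, hM,
      conjTranspose_mul, conjTranspose_mul, conjTranspose_conjTranspose, submatrix_id_id,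
      Matrix.mul_assoc]

theorem IsPhaseVector.sum_compression_lt {k : ℕ} {M : Matrix ι ι ℂ} {φ : Fin (k + 1) → ℝ}
    (hφ : IsPhaseVector M φ) {X : Matrix ι κ ℂ} {θ : Fin k → ℝ}
    (hθ : IsPhaseVector (Xᴴ * M * X) θ) : ∑ i, θ i - Real.pi / 2 < ∑ i, φ i := by
  rw [Fin.sum_univ_castSucc]
  have h : ∑ i, θ i ≤ ∑ i : Fin k, φ i.castSucc :=
    Finset.sum_le_sum fun j _ => hφ.le_of_compression hθ rfl
  linarith [(hφ.mem_Ioo (Fin.last k)).1]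

theorem IsPhaseVector.abs_sum_sub_sum_lt {k : ℕ} {M : Matrix ι ι ℂ} {φ : Fin (k + 1) → ℝ}
    (hφ : IsPhaseVector M φ) {X : Matrix ι κ ℂ} {θ : Fin k → ℝ}
    (hθ : IsPhaseVector (Xᴴ * M * X) θ) : |∑ i, φ i - ∑ i, θ i| < Real.pi / 2 := by
  have h1 := hφ.sum_compression_lt hθ
  have hθ' := hθ.conjTranspose
  rw [conjTranspose_mul, conjTranspose_mul, conjTranspose_conjTranspose, ← Matrix.mul_assoc]
    at hθ'
  have h2 := hφ.conjTranspose.sum_compression_lt hθ'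
  have hrev : ∀ {n : ℕ} (f : Fin n → ℝ), ∑ i : Fin n, -f i.rev = -∑ i, f i := fun f => by
    rw [Finset.sum_neg_distrib]
    exact congrArg _ (Equiv.sum_comp Fin.revPerm f)
  rw [hrev, hrev] at h2
  rw [abs_lt]
  constructor <;> linarith

end Interlacing

section PhaseSum

theorem exp_sum_phases_mul_det {N : ℕ} {M : Matrix (Fin N) (Fin N) ℂ} {θ : Fin N → ℝ}
    (hθ : IsPhaseVector M θ) :
    ∃ r : ℝ, 0 < r ∧ M.det = r * Complex.exp ((∑ i, θ i : ℝ) * Complex.I) := by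
  obtain ⟨T, R, hTR, -, hM⟩ := hθ.decomposition
  have hT : T.det ≠ 0 := fun h => by simpa [h] using congrArg det hTR
  refine ⟨Complex.normSq T.det, Complex.normSq_pos.2 hT, ?_⟩
  rw [hM, det_mul, det_mul, det_conjTranspose, phaseDiag, det_diagonal, ← Complex.exp_sum,
    ← Finset.sum_mul, Complex.normSq_eq_conj_mul_self]
  push_cast
  simp only [RCLike.star_def]
  ring

theorem eq_of_exp_eq_of_abs_lt {a b r s : ℝ} (hr : 0 < r) (hs : 0 < s)
    (h : (r : ℂ) * Complex.exp (a * Complex.I) = s * Complex.exp (b * Complex.I))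
    (hab : |a - b| < 2 * Real.pi) : a = b := by
  have hrs : r = s := by
    have := congrArg norm h
    simpa [Complex.norm_exp_ofReal_mul_I, abs_of_pos hr, abs_of_pos hs] using this
  subst hrs
  have h1 := mul_left_cancel₀ (Complex.ofReal_ne_zero.2 hr.ne') h
  obtain ⟨n, hn⟩ := Complex.exp_eq_exp_iff_exists_int.1 h1
  have hn' : a = b + n * (2 * Real.pi) := by
    have h2 : (a : ℂ) = b + n * (2 * Real.pi) := by
      apply mul_right_cancel₀ Complex.I_ne_zero
      rw [hn]
      ring
    exact_mod_cast h2
  have h2 : |(n : ℝ)| < 1 := by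
    have : |(n : ℝ)| * (2 * Real.pi) < 1 * (2 * Real.pi) := by
      rw [one_mul]
      calc |(n : ℝ)| * (2 * Real.pi) = |a - b| := by
            rw [hn', add_sub_cancel_left, abs_mul, abs_of_pos Real.two_pi_pos]
        _ < _ := hab
    exact lt_of_mul_lt_mul_right this Real.two_pi_pos.le
  have h3 : n = 0 := by
    rw [← Int.abs_lt_one_iff]
    exact_mod_cast h2
  simpa [h3] using hn'

theorem phaseDiag_mul_mul_apply {ι : Type*} [Fintype ι] [DecidableEq ι] (ψ : ι → ℝ)
    (P : Matrix ι ι ℂ) (i j : ι) : (phaseDiag ψ * P * phaseDiag ψ) i j =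
      Complex.exp ((ψ i : ℂ) * Complex.I) * P i j * Complex.exp ((ψ j : ℂ) * Complex.I) := by
  rw [phaseDiag, mul_diagonal, diagonal_mul]

/-- Selecting columns along an embedding, as a multiplication by a `0`-`1` matrix. -/
theorem submatrix_eq_mul {ι κ : Type*} [Fintype ι] [DecidableEq ι] [Fintype κ]
    (M : Matrix ι ι ℂ) (f : κ → ι) : M.submatrix f f =
      ((1 : Matrix ι ι ℂ).submatrix id f)ᴴ * M * (1 : Matrix ι ι ℂ).submatrix id f := by
  ext a b
  simp [Matrix.mul_apply, Matrix.one_apply, eq_comm]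

theorem strictlyAccretive_submatrix {ι κ : Type*} [Fintype ι] [DecidableEq ι] [Fintype κ]
    {M : Matrix ι ι ℂ} (hM : StrictlyAccretive M) {f : κ → ι} (hf : Function.Injective f) :
    StrictlyAccretive (M.submatrix f f) := by
  classical
  rw [submatrix_eq_mul]
  refine hM.congruence (mulVec_eq_zero_of_leftInverse
    (Y := (1 : Matrix ι ι ℂ).submatrix f id) ?_)
  rw [← submatrix_mul _ _ _ _ _ Function.bijective_id, Matrix.one_mul, submatrix_one _ hf]

theorem sum_phases_eq {N : ℕ} (ψ : Fin N → ℝ)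
    (hψ : ∀ k, ψ k ∈ Set.Ioo (-(Real.pi / 2)) (Real.pi / 2)) (P : Matrix (Fin N) (Fin N) ℂ)
    (hP : P.PosDef) (hacc : StrictlyAccretive (phaseDiag ψ * P * phaseDiag ψ)) (θ : Fin N → ℝ)
    (hθ : IsPhaseVector (phaseDiag ψ * P * phaseDiag ψ) θ) : ∑ i, θ i = 2 * ∑ i, ψ i := by
  induction N with
  | zero => simp
  | succ k ih =>
    have hsub : (phaseDiag ψ * P * phaseDiag ψ).submatrix Fin.castSucc Fin.castSucc =
        phaseDiag (ψ ∘ Fin.castSucc) * P.submatrix Fin.castSucc Fin.castSucc *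
          phaseDiag (ψ ∘ Fin.castSucc) := by
      ext i j
      rw [submatrix_apply, phaseDiag_mul_mul_apply, phaseDiag_mul_mul_apply]
      rfl
    have hacc' := strictlyAccretive_submatrix hacc (Fin.castSucc_injective k)
    obtain ⟨θ', hθ'⟩ := hacc'.exists_isPhaseVector (Fintype.card_fin k)
    have hIH := ih (ψ ∘ Fin.castSucc) (fun i => hψ _) _
      (hP.submatrix (Fin.castSucc_injective k)) (hsub ▸ hacc') θ' (hsub ▸ hθ')
    have hlt := hθ.abs_sum_sub_sum_lt
      ((submatrix_eq_mul (phaseDiag ψ * P * phaseDiag ψ) Fin.castSucc) ▸ hθ')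
    obtain ⟨r, hr, hdet⟩ := exp_sum_phases_mul_det hθ
    have hPd := hP.det_pos
    have hPr : P.det = (P.det.re : ℂ) := by
      obtain ⟨-, h⟩ := Complex.lt_def.1 hPd
      apply Complex.ext <;> simp [← h]
    have hPd' : 0 < P.det.re := (Complex.lt_def.1 hPd).1
    refine eq_of_exp_eq_of_abs_lt hr hPd' ?_ ?_
    · rw [← hdet, det_mul, det_mul, phaseDiag, det_diagonal, ← Complex.exp_sum,
        ← Finset.sum_mul, mul_right_comm, ← Complex.exp_add, ← hPr, mul_comm]
      push_cast
      ring_nf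
    · rw [Fin.sum_univ_castSucc ψ]
      have h1 := hψ (Fin.last k)
      simp only [Function.comp] at hIH
      rw [hIH] at hlt
      rw [abs_lt] at hlt ⊢
      constructor <;> linarith [h1.1, h1.2, hlt.1, hlt.2]

variable {ι : Type*} [Fintype ι] [DecidableEq ι]

theorem sum_phases_square {N k : ℕ} {S : Matrix ι ι ℂ} (hS2 : StrictlyAccretive (S * S))
    {ψ : Fin N → ℝ} (hψ : IsPhaseVector S ψ)
    (f : Fin k → Fin N) (hf : Function.Injective f) :
    ∃ (X : Matrix ι (Fin k) ℂ) (θ : Fin k → ℝ), IsPhaseVector (Xᴴ * (S * S) * X) θ ∧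
      ∑ i, θ i = 2 * ∑ i, ψ (f i) := by
  obtain ⟨T, R, hTR, hRT, hS⟩ := hψ.decomposition
  have hinj : Function.Injective fun v : Fin N → ℂ => v ᵥ* T := fun v w h => by
    have := congrArg (fun u => u ᵥ* R) h
    simpa [vecMul_vecMul, hTR] using this
  have hP : (T * Tᴴ).PosDef := PosDef.mul_conjTranspose_self T hinj
  have hfull : Rᴴ * (S * S) * R = phaseDiag ψ * (T * Tᴴ) * phaseDiag ψ := by
    have h1 : Rᴴ * Tᴴ = 1 := by rw [← conjTranspose_mul, hTR, conjTranspose_one]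
    calc Rᴴ * (S * S) * R
        = (Rᴴ * Tᴴ) * phaseDiag ψ * (T * Tᴴ) * phaseDiag ψ * (T * R) := by
          rw [hS]; simp only [Matrix.mul_assoc]
      _ = _ := by rw [h1, hTR]; simp only [Matrix.mul_one, Matrix.one_mul, Matrix.mul_assoc]
  have hsub : (phaseDiag ψ * (T * Tᴴ) * phaseDiag ψ).submatrix f f =
      phaseDiag (ψ ∘ f) * (T * Tᴴ).submatrix f f * phaseDiag (ψ ∘ f) := by
    ext i j
    rw [submatrix_apply, phaseDiag_mul_mul_apply, phaseDiag_mul_mul_apply]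
    rfl
  have hacc : StrictlyAccretive (phaseDiag ψ * (T * Tᴴ) * phaseDiag ψ) := by
    rw [← hfull]
    exact hS2.congruence (mulVec_eq_zero_of_leftInverse hTR)
  have hacc' := strictlyAccretive_submatrix hacc hf
  obtain ⟨θ, hθ⟩ := hacc'.exists_isPhaseVector (Fintype.card_fin k)
  refine ⟨R * (1 : Matrix (Fin N) (Fin N) ℂ).submatrix id f, θ, ?_, ?_⟩
  · rw [submatrix_eq_mul, ← hfull] at hθ
    rw [conjTranspose_mul]
    convert hθ using 1
    simp only [Matrix.mul_assoc]
  · exact sum_phases_eq (ψ ∘ f) (fun i => hψ.mem_Ioo _) _ (hP.submatrix hf) (hsub ▸ hacc') θ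
      (hsub ▸ hθ)

theorem two_mul_sum_phases_le {N k : ℕ} (hk : k ≤ N) {S : Matrix ι ι ℂ}
    (hS2 : StrictlyAccretive (S * S)) {ψ φ : Fin N → ℝ} (hψ : IsPhaseVector S ψ)
    (hφ : IsPhaseVector (S * S) φ) :
    2 * ∑ i : Fin k, ψ (i.castLE hk) ≤ ∑ i : Fin k, φ (i.castLE hk) := by
  obtain ⟨X, θ, hθ, hsum⟩ := sum_phases_square hS2 hψ (Fin.castLE hk)
    (Fin.castLE_injective hk)
  rw [← hsum]
  exact Finset.sum_le_sum fun j _ => hφ.le_of_compression hθ rfl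

theorem two_mul_sum_phases_eq {N : ℕ} {S : Matrix ι ι ℂ}
    (hS2 : StrictlyAccretive (S * S)) {ψ φ : Fin N → ℝ} (hψ : IsPhaseVector S ψ)
    (hφ : IsPhaseVector (S * S) φ) : 2 * ∑ i, ψ i = ∑ i, φ i := by
  refine le_antisymm (two_mul_sum_phases_le le_rfl hS2 hψ hφ) ?_
  have h2 : Sᴴ * Sᴴ = (S * S)ᴴ := (conjTranspose_mul S S).symm
  have h := two_mul_sum_phases_le le_rfl (h2 ▸ hS2.conjTranspose) hψ.conjTranspose
    (h2 ▸ hφ.conjTranspose)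
  have hrev : ∀ f : Fin N → ℝ, ∑ i : Fin N, -f i.rev = -∑ i, f i := fun f => by
    rw [Finset.sum_neg_distrib]
    exact congrArg _ (Equiv.sum_comp Fin.revPerm f)
  have h' : 2 * ∑ i : Fin N, -ψ i.rev ≤ ∑ i : Fin N, -φ i.rev := h
  rw [hrev, hrev] at h'
  linarith

end PhaseSum

section DunfordTaylor

open Polynomial

/-- Division of a holomorphic function by a product of linear factors: the remainder is a
polynomial and the quotient is holomorphic. -/
theorem exists_polynomial_remainder {U : Set ℂ} (hU : IsOpen U) (s : Multiset ℂ) :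
    (∀ a ∈ s, a ∈ U) → ∀ f : ℂ → ℂ, DifferentiableOn ℂ f U →
      ∃ (q : ℂ[X]) (g : ℂ → ℂ), DifferentiableOn ℂ g U ∧
        ∀ z, f z = q.eval z + (s.map fun a => X - C a).prod.eval z * g z := by
  induction s using Multiset.induction_on with
  | empty => exact fun _ f hf => ⟨0, f, hf, fun z => by simp⟩
  | cons a s ih =>
    intro hs f hf
    have ha : a ∈ U := hs a (Multiset.mem_cons_self a s)
    have hd := (Complex.differentiableOn_dslope (hU.mem_nhds ha)).2 hf
    obtain ⟨q, g, hg, h⟩ := ih (fun b hb => hs b (Multiset.mem_cons_of_mem hb)) _ hd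
    refine ⟨C (f a) + (X - C a) * q, g, hg, fun z => ?_⟩
    have h1 := sub_smul_dslope f a z
    rw [h z, smul_eq_mul] at h1
    rw [Multiset.map_cons, Multiset.prod_cons, eval_add, eval_mul, eval_mul, eval_C, eval_sub,
      eval_X, eval_C]
    linear_combination -h1

variable {n : ℕ} (M : Matrix (Fin n) (Fin n) ℂ)

theorem charpoly_eq_prod_roots :
    M.charpoly = (M.charpoly.roots.map fun a => X - C a).prod :=
  ((IsAlgClosed.splits M.charpoly).eq_prod_roots_of_monic M.charpoly_monic)

theorem det_smul_one_sub (z : ℂ) : (z • (1 : Matrix (Fin n) (Fin n) ℂ) - M).det =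
    M.charpoly.eval z := by
  rw [eval_charpoly, smul_one_eq_diagonal]
  rfl

theorem eval_charpoly_ne_zero {z : ℂ} (hz : z ∉ spectrum ℂ M) : M.charpoly.eval z ≠ 0 :=
  fun h => hz (mem_spectrum_iff_isRoot_charpoly.2 h)

theorem resolvent_mul_self {z : ℂ} (hz : z ∉ spectrum ℂ M) :
    (z • (1 : Matrix (Fin n) (Fin n) ℂ) - M)⁻¹ * (z • (1 : Matrix (Fin n) (Fin n) ℂ) - M) = 1 :=
  nonsing_inv_mul _ (by
    rw [det_smul_one_sub]
    exact (eval_charpoly_ne_zero M hz).isUnit)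

theorem exists_polynomial_adjugate (a b : Fin n) : ∃ p : ℂ[X], ∀ z : ℂ,
    (z • (1 : Matrix (Fin n) (Fin n) ℂ) - M).adjugate a b = p.eval z := by
  refine ⟨(charmatrix M).adjugate a b, fun z => ?_⟩
  have h : z • (1 : Matrix (Fin n) (Fin n) ℂ) - M = (evalRingHom z).mapMatrix (charmatrix M) := by
    ext i j
    rcases eq_or_ne i j with rfl | hij
    · simp [charmatrix_apply_eq]
    · simp [hij]
  rw [h, ← RingHom.map_adjugate]
  rfl

theorem resolvent_apply_eq (z : ℂ) (a b : Fin n) :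
    (z • (1 : Matrix (Fin n) (Fin n) ℂ) - M)⁻¹ a b =
      (M.charpoly.eval z)⁻¹ * (z • (1 : Matrix (Fin n) (Fin n) ℂ) - M).adjugate a b := by
  rw [inv_def, det_smul_one_sub, Ring.inverse_eq_inv']
  rfl

theorem differentiableAt_resolvent {z : ℂ} (hz : z ∉ spectrum ℂ M) (a b : Fin n) :
    DifferentiableAt ℂ (fun z : ℂ => (z • (1 : Matrix (Fin n) (Fin n) ℂ) - M)⁻¹ a b) z := by
  obtain ⟨p, hp⟩ := exists_polynomial_adjugate M a b
  have : (fun z : ℂ => (z • (1 : Matrix (Fin n) (Fin n) ℂ) - M)⁻¹ a b) =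
      fun z => (M.charpoly.eval z)⁻¹ * p.eval z := by
    funext w
    rw [resolvent_apply_eq, hp]
  rw [this]
  exact (M.charpoly.differentiable.differentiableAt.inv (eval_charpoly_ne_zero M hz)).mul
    p.differentiable.differentiableAt

open scoped Matrix.Norms.Operator in
theorem tendsto_resolvent_apply (a b : Fin n) :
    Filter.Tendsto (fun z : ℂ => (z • (1 : Matrix (Fin n) (Fin n) ℂ) - M)⁻¹ a b)
      (Bornology.cobounded ℂ) (nhds 0) := by
  have h := spectrum.resolvent_tendsto_cobounded (𝕜 := ℂ) M
  have h2 : Filter.Tendsto (fun z : ℂ => resolvent M z a b) (Bornology.cobounded ℂ)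
      (nhds ((0 : Matrix (Fin n) (Fin n) ℂ) a b)) :=
    ((continuous_id.matrix_elem a b).tendsto _).comp h
  refine h2.congr fun z => ?_
  rw [resolvent, ← nonsing_inv_eq_ringInverse, Algebra.algebraMap_eq_smul_one]

/-- An entire polynomial relation `q(z) - q(M) = (z - M) R(z)` with `R` entire. -/
theorem exists_quotient_aeval (q : ℂ[X]) : ∃ R : ℂ → Matrix (Fin n) (Fin n) ℂ,
    (∀ a b, Differentiable ℂ fun z => R z a b) ∧ ∀ z : ℂ,
      q.eval z • (1 : Matrix (Fin n) (Fin n) ℂ) =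
        aeval M q + (z • (1 : Matrix (Fin n) (Fin n) ℂ) - M) * R z := by
  induction q using Polynomial.induction_on' with
  | add p q hp hq =>
    obtain ⟨R, hR, h⟩ := hp
    obtain ⟨S, hS, h'⟩ := hq
    refine ⟨fun z => R z + S z, fun a b => (hR a b).add (hS a b), fun z => ?_⟩
    rw [eval_add, add_smul, h, h', map_add, Matrix.mul_add]
    abel
  | monomial k c =>
    induction k with
    | zero =>
      refine ⟨fun _ => 0, fun a b => differentiable_const _, fun z => ?_⟩
      simp [Algebra.algebraMap_eq_smul_one]
    | succ k ih =>
      obtain ⟨R, hR, h⟩ := ih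
      refine ⟨fun z => z • R z + aeval M (monomial k c), fun a b =>
        (differentiable_id.mul (hR a b)).add (differentiable_const _), fun z => ?_⟩
      have h1 : (monomial (k + 1) c : ℂ[X]) = X * monomial k c := by
        rw [X_mul_monomial]
      rw [h1, eval_mul, eval_X, mul_smul, h, map_mul, aeval_X]
      simp only [Matrix.mul_add, smul_add, Matrix.mul_smul, Matrix.sub_mul, Matrix.smul_mul,
        Matrix.one_mul, smul_sub]
      abel

variable {M} {c : ℂ} {r : ℝ}

theorem IsContour.notMem_spectrum (h : IsContour M c r) {z : ℂ} (hz : z ∈ Metric.sphere c r) :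
    z ∉ spectrum ℂ M := fun hs => by
  have h1 := h.2.2 hs
  rw [Metric.mem_ball] at h1
  rw [Metric.mem_sphere] at hz
  linarith

theorem IsContour.continuousOn_resolvent (h : IsContour M c r) (a b : Fin n) :
    ContinuousOn (fun z : ℂ => (z • (1 : Matrix (Fin n) (Fin n) ℂ) - M)⁻¹ a b)
      (Metric.sphere c r) := fun _ hz =>
  (differentiableAt_resolvent M (h.notMem_spectrum hz) a b).continuousAt.continuousWithinAt

theorem IsContour.integral_resolvent (h : IsContour M c r) (a b : Fin n) :
    ∮ z in C(c, r), (z • (1 : Matrix (Fin n) (Fin n) ℂ) - M)⁻¹ a b =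
      2 * Real.pi * Complex.I * (1 : Matrix (Fin n) (Fin n) ℂ) a b := by
  set E : ℂ → ℂ := fun z =>
    ((z • (1 : Matrix (Fin n) (Fin n) ℂ) - M)⁻¹ * (M - c • (1 : Matrix (Fin n) (Fin n) ℂ))) a b
  have hE : Filter.Tendsto E (Bornology.cobounded ℂ) (nhds 0) := by
    have : Filter.Tendsto E (Bornology.cobounded ℂ)
        (nhds (∑ k, 0 * (M - c • (1 : Matrix (Fin n) (Fin n) ℂ)) k b)) :=
      tendsto_finsetSum _ fun k _ => (tendsto_resolvent_apply M a k).mul_const _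
    simpa using this
  have hbound : ∀ ε > 0, ‖(∮ z in C(c, r), (z • (1 : Matrix (Fin n) (Fin n) ℂ) - M)⁻¹ a b) -
      2 * Real.pi * Complex.I * (1 : Matrix (Fin n) (Fin n) ℂ) a b‖ ≤ 2 * Real.pi * ε := by
    intro ε hε
    have hev := (Metric.tendsto_nhds.1 hE ε hε)
    rw [(Metric.hasBasis_cobounded_compl_ball c).eventually_iff] at hev
    obtain ⟨R₀, -, hR₀⟩ := hev
    set R := max r R₀
    have hrR : r ≤ R := le_max_left _ _
    have hR : 0 < R := h.1.trans_le hrR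
    have hns : ∀ z ∉ Metric.ball c r, z ∉ spectrum ℂ M := fun z hz hs => hz (h.2.2 hs)
    have h1 := Complex.circleIntegral_eq_of_differentiable_on_annulus_off_countable h.1 hrR
      (f := fun z : ℂ => (z • (1 : Matrix (Fin n) (Fin n) ℂ) - M)⁻¹ a b) Set.countable_empty
      (fun z hz => (differentiableAt_resolvent M (hns z hz.2) a b).continuousAt.continuousWithinAt)
      (fun z hz => differentiableAt_resolvent M
        (hns z fun hb => hz.1.2 (Metric.ball_subset_closedBall hb)) a b)
    have hsph : ∀ z ∈ Metric.sphere c R, z ∉ Metric.ball c r := fun z hz hb => by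
      rw [Metric.mem_sphere] at hz
      rw [Metric.mem_ball] at hb
      linarith
    have h2 : 2 * Real.pi * Complex.I * (1 : Matrix (Fin n) (Fin n) ℂ) a b =
        ∮ z in C(c, R), (1 : Matrix (Fin n) (Fin n) ℂ) a b * (z - c)⁻¹ := by
      rw [circleIntegral.integral_const_mul, circleIntegral.integral_sub_center_inv c hR.ne',
        mul_comm]
    rw [← h1, h2, ← circleIntegral.integral_sub]
    · have h3 := circleIntegral.norm_integral_le_of_norm_le_const (c := c) (C := ε / R) hR.le
        (f := fun z => (z • (1 : Matrix (Fin n) (Fin n) ℂ) - M)⁻¹ a b -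
          (1 : Matrix (Fin n) (Fin n) ℂ) a b * (z - c)⁻¹) ?_
      · calc _ ≤ _ := h3
          _ = 2 * Real.pi * ε := by field_simp
      · intro z hz
        have hzc : ‖z - c‖ = R := by simpa [dist_eq_norm] using hz
        have hzc0 : z - c ≠ 0 := norm_pos_iff.1 (hzc ▸ hR)
        have hid : (z • (1 : Matrix (Fin n) (Fin n) ℂ) - M)⁻¹ a b -
            (1 : Matrix (Fin n) (Fin n) ℂ) a b * (z - c)⁻¹ = E z * (z - c)⁻¹ := by
          have h4 := resolvent_mul_self M (hns z (hsph z hz))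
          have h5 : (z • (1 : Matrix (Fin n) (Fin n) ℂ) - M)⁻¹ *
              (M - c • (1 : Matrix (Fin n) (Fin n) ℂ)) =
              (z - c) • (z • (1 : Matrix (Fin n) (Fin n) ℂ) - M)⁻¹ - 1 := by
            have : M - c • (1 : Matrix (Fin n) (Fin n) ℂ) =
                (z - c) • 1 - (z • (1 : Matrix (Fin n) (Fin n) ℂ) - M) := by
              rw [sub_smul]; abel
            rw [this, Matrix.mul_sub, h4, Matrix.mul_smul, Matrix.mul_one]
          have h6 : E z = (z - c) * (z • (1 : Matrix (Fin n) (Fin n) ℂ) - M)⁻¹ a b -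
              (1 : Matrix (Fin n) (Fin n) ℂ) a b := congrFun (congrFun h5 a) b
          rw [h6]
          field_simp
        have hEz : ‖E z‖ < ε := by
          have : z ∈ (Metric.ball c R₀)ᶜ := fun hb => by
            rw [Metric.mem_ball, dist_eq_norm, hzc] at hb
            exact absurd (le_max_right r R₀) (not_le.2 hb)
          simpa using hR₀ this
        rw [hid, norm_mul, norm_inv, hzc, div_eq_mul_inv]
        exact mul_le_mul_of_nonneg_right hEz.le (inv_nonneg.2 hR.le)
    · refine ContinuousOn.circleIntegrable hR.le fun z hz => ?_
      exact (differentiableAt_resolvent M (hns z (hsph z hz)) a b).continuousAt.continuousWithinAt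
    · refine ContinuousOn.circleIntegrable hR.le (continuousOn_const.mul
        ((continuousOn_id.sub continuousOn_const).inv₀ fun z hz => ?_))
      have hzc : ‖z - c‖ = R := by simpa [dist_eq_norm] using hz
      exact norm_pos_iff.1 (hzc ▸ hR)
  rw [← sub_eq_zero, ← norm_le_zero_iff]
  refine le_of_forall_pos_le_add fun ε hε => ?_
  have := hbound (ε / (2 * Real.pi)) (div_pos hε Real.two_pi_pos)
  rwa [mul_div_cancel₀ _ Real.two_pi_pos.ne', ← zero_add ε] at this

theorem IsContour.integral_eq_aeval_of_eq_add (h : IsContour M c r) {f g : ℂ → ℂ} {q : ℂ[X]}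
    (hg : DifferentiableOn ℂ g Complex.slitPlane)
    (hf : ∀ z, f z = q.eval z + M.charpoly.eval z * g z) (a b : Fin n) :
    ∮ z in C(c, r), (z • (1 : Matrix (Fin n) (Fin n) ℂ) - M)⁻¹ a b * f z =
      2 * Real.pi * Complex.I * aeval M q a b := by
  obtain ⟨R, hR, hq⟩ := exists_quotient_aeval M q
  obtain ⟨p, hp⟩ := exists_polynomial_adjugate M a b
  have hgd : ∀ z ∈ Metric.closedBall c r, DifferentiableAt ℂ g z := fun z hz =>
    hg.differentiableAt (Complex.isOpen_slitPlane.mem_nhds (h.2.1 hz))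
  have hcong : Set.EqOn
      (fun z => (z • (1 : Matrix (Fin n) (Fin n) ℂ) - M)⁻¹ a b * f z)
      (fun z => ∑ k, (z • (1 : Matrix (Fin n) (Fin n) ℂ) - M)⁻¹ a k * aeval M q k b +
        (R z a b + p.eval z * g z)) (Metric.sphere c r) := by
    intro z hz
    have hz' := h.notMem_spectrum hz
    have h0 : q.eval z • (z • (1 : Matrix (Fin n) (Fin n) ℂ) - M)⁻¹ =
        (z • (1 : Matrix (Fin n) (Fin n) ℂ) - M)⁻¹ * aeval M q + R z := by
      rw [← Matrix.mul_one (z • (1 : Matrix (Fin n) (Fin n) ℂ) - M)⁻¹, ← Matrix.mul_smul, hq z,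
        Matrix.mul_add, ← Matrix.mul_assoc, Matrix.mul_one, resolvent_mul_self M hz',
        Matrix.one_mul]
    have h1 := congrFun (congrFun h0 a) b
    have h2 : (z • (1 : Matrix (Fin n) (Fin n) ℂ) - M)⁻¹ a b * M.charpoly.eval z = p.eval z := by
      rw [resolvent_apply_eq, hp, mul_right_comm,
        inv_mul_cancel₀ (eval_charpoly_ne_zero M hz'), one_mul]
    simp only [Matrix.smul_apply, Matrix.add_apply, smul_eq_mul, Matrix.mul_apply] at h1
    simp only [hf]
    linear_combination h1 + g z * h2
  rw [circleIntegral.integral_congr h.1.le hcong, circleIntegral.integral_add,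
    circleIntegral.integral_fun_sum]
  · have hz : ∮ z in C(c, r), (R z a b + p.eval z * g z) = 0 := by
      have hd : ∀ z ∈ Metric.closedBall c r,
          DifferentiableAt ℂ (fun z => R z a b + p.eval z * g z) z := fun z hz =>
        (hR a b z).add (p.differentiable.differentiableAt.mul (hgd z hz))
      exact Complex.circleIntegral_eq_zero_of_differentiable_on_off_countable h.1.le
        Set.countable_empty (fun z hz => (hd z hz).continuousAt.continuousWithinAt)
        (fun z hz => hd z (Metric.ball_subset_closedBall hz.1))
    rw [hz, add_zero]
    have : ∀ k, ∮ z in C(c, r), (z • (1 : Matrix (Fin n) (Fin n) ℂ) - M)⁻¹ a k * aeval M q k b =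
        2 * Real.pi * Complex.I * ((1 : Matrix (Fin n) (Fin n) ℂ) a k * aeval M q k b) := by
      intro k
      simp_rw [mul_comm _ (aeval M q k b)]
      rw [circleIntegral.integral_const_mul, h.integral_resolvent]
      ring
    rw [Finset.sum_congr rfl fun k _ => this k, ← Finset.mul_sum, ← Matrix.mul_apply,
      Matrix.one_mul]
  · intro k _
    exact ((h.continuousOn_resolvent a k).mul continuousOn_const).circleIntegrable h.1.le
  · refine ContinuousOn.circleIntegrable h.1.le (continuousOn_finsetSum _ fun k _ => ?_)
    exact (h.continuousOn_resolvent a k).mul continuousOn_const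
  · refine ContinuousOn.circleIntegrable h.1.le fun z hz => ?_
    exact ((hR a b z).continuousAt.add (p.continuous.continuousAt.mul
      (hgd z (Metric.sphere_subset_closedBall hz)).continuousAt)).continuousWithinAt

theorem re_sqrt_pos {z : ℂ} (hz : z ∈ Complex.slitPlane) : 0 < (z ^ ((1 / 2 : ℝ) : ℂ)).re := by
  have h0 : z ≠ 0 := Complex.slitPlane_ne_zero hz
  rw [Complex.cpow_def_of_ne_zero h0, Complex.exp_re]
  refine mul_pos (Real.exp_pos _) (Real.cos_pos_of_mem_Ioo ?_)
  rw [Complex.im_mul_ofReal, Complex.log_im]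
  have h1 := Complex.neg_pi_lt_arg z
  have h2 : z.arg < Real.pi :=
    lt_of_le_of_ne (Complex.arg_le_pi z) (Complex.mem_slitPlane_iff_arg.1 hz).1
  constructor <;> linarith

theorem sqrt_mul_sqrt (z : ℂ) : z ^ ((1 / 2 : ℝ) : ℂ) * z ^ ((1 / 2 : ℝ) : ℂ) = z := by
  rw [← sq]
  have : ((1 / 2 : ℝ) : ℂ) = ((2 : ℕ) : ℂ)⁻¹ := by push_cast; norm_num
  rw [this, Complex.cpow_nat_inv_pow z two_ne_zero]

theorem IsContour.dunfordTaylor_half (h : IsContour M c r) :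
    dunfordTaylor M (1 / 2) c r * dunfordTaylor M (1 / 2) c r = M ∧
      ∀ μ ∈ spectrum ℂ (dunfordTaylor M (1 / 2) c r), 0 < μ.re := by
  have hroots : ∀ a ∈ M.charpoly.roots, a ∈ Complex.slitPlane := fun a ha =>
    h.2.1 (Metric.ball_subset_closedBall (h.2.2
      (mem_spectrum_iff_isRoot_charpoly.2 (isRoot_of_mem_roots ha))))
  have hsq : DifferentiableOn ℂ (fun z : ℂ => z ^ ((1 / 2 : ℝ) : ℂ)) Complex.slitPlane :=
    fun z hz => (differentiableAt_id.cpow_const hz).differentiableWithinAt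
  obtain ⟨q, g, hg, hf⟩ := exists_polynomial_remainder Complex.isOpen_slitPlane
    M.charpoly.roots hroots _ hsq
  rw [← charpoly_eq_prod_roots] at hf
  have hq : dunfordTaylor M (1 / 2) c r = aeval M q := by
    ext a b
    rw [dunfordTaylor, Matrix.of_apply, h.integral_eq_aeval_of_eq_add hg hf,
      inv_mul_cancel_left₀ Complex.two_pi_I_ne_zero]
  have hX : aeval M (X - q * q) = 0 := by
    have hk : DifferentiableOn ℂ (fun z => 2 * q.eval z * g z + M.charpoly.eval z * (g z * g z))
        Complex.slitPlane :=
      (((differentiableOn_const _).mul q.differentiable.differentiableOn).mul hg).add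
        (M.charpoly.differentiable.differentiableOn.mul (hg.mul hg))
    ext a b
    have h1 := h.integral_eq_aeval_of_eq_add (f := fun z => (X - q * q).eval z)
      (q := X - q * q) (g := 0) (differentiableOn_const 0) (fun z => by simp) a b
    have h2 := h.integral_eq_aeval_of_eq_add (f := fun z => (X - q * q).eval z)
      (q := 0) hk (fun z => by
        have h3 := sqrt_mul_sqrt z
        have h4 := hf z
        rw [h4] at h3
        simp only [eval_sub, eval_X, eval_mul, eval_zero]
        linear_combination -h3) a b
    rw [h1] at h2
    have h5 := mul_left_cancel₀ Complex.two_pi_I_ne_zero h2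
    simpa using h5
  rw [hq]
  refine ⟨?_, fun μ hμ => ?_⟩
  · rw [← map_mul, eq_comm, ← sub_eq_zero]
    simpa using hX
  · rcases subsingleton_or_nontrivial (Matrix (Fin n) (Fin n) ℂ) with hs | hs
    · simp [spectrum.of_subsingleton] at hμ
    rw [spectrum.map_polynomial_aeval_of_nonempty _ _
      (spectrum.nonempty_of_isAlgClosed_of_finiteDimensional ℂ M)] at hμ
    obtain ⟨z, hz, rfl⟩ := hμ
    have h1 := hf z
    have h2 : M.charpoly.eval z = 0 := mem_spectrum_iff_isRoot_charpoly.1 hz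
    simp only [h2, zero_mul, add_zero] at h1
    simp only
    rw [← h1]
    exact re_sqrt_pos (h.2.1 (Metric.ball_subset_closedBall (h.2.2 hz)))

variable (M) in
theorem exists_isContour (hM : ∀ μ ∈ spectrum ℂ M, 0 < μ.re) :
    ∃ q : ℂ × ℝ, IsContour M q.1 q.2 := by
  have hfin := M.finite_spectrum
  obtain ⟨δ, hδ, hδ'⟩ : ∃ δ : ℝ, 0 < δ ∧ ∀ μ ∈ spectrum ℂ M, δ < μ.re := by
    have h1 : ∀ᶠ δ in nhdsWithin (0 : ℝ) (Set.Ioi 0), ∀ μ ∈ spectrum ℂ M, δ < μ.re := by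
      rw [Filter.eventually_all_finite hfin]
      exact fun μ hμ => nhdsWithin_le_nhds (eventually_lt_nhds (hM μ hμ))
    obtain ⟨δ, h2, h3⟩ := (h1.and self_mem_nhdsWithin).exists
    exact ⟨δ, h3, h2⟩
  obtain ⟨t, htδ, ht⟩ : ∃ t : ℝ, δ < t ∧ ∀ μ ∈ spectrum ℂ M,
      Complex.normSq μ - δ ^ 2 < 2 * t * (μ.re - δ) := by
    have h1 : ∀ᶠ t in Filter.atTop, ∀ μ ∈ spectrum ℂ M,
        Complex.normSq μ - δ ^ 2 < 2 * t * (μ.re - δ) := by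
      rw [Filter.eventually_all_finite hfin]
      intro μ hμ
      have h2 := (Filter.tendsto_id.const_mul_atTop (two_pos : (0 : ℝ) < 2)).atTop_mul_const
        (sub_pos.2 (hδ' μ hμ))
      exact h2.eventually_gt_atTop _
    obtain ⟨t, h2, h3⟩ := (h1.and (Filter.eventually_gt_atTop δ)).exists
    exact ⟨t, h3, h2⟩
  refine ⟨((t : ℂ), t - δ), sub_pos.2 htδ, fun z hz => Or.inl ?_, fun μ hμ => ?_⟩
  · rw [Metric.mem_closedBall, dist_eq_norm] at hz
    have h1 := (Complex.abs_re_le_norm (z - t)).trans hz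
    rw [Complex.sub_re, Complex.ofReal_re, abs_le] at h1
    linarith [h1.1]
  · rw [Metric.mem_ball, dist_eq_norm]
    refine lt_of_pow_lt_pow_left₀ 2 (sub_pos.2 htδ).le ?_
    have h1 := ht μ hμ
    rw [Complex.normSq_apply] at h1
    rw [← Complex.normSq_eq_norm_sq, Complex.normSq_apply, Complex.sub_re, Complex.sub_im,
      Complex.ofReal_re, Complex.ofReal_im, sub_zero]
    nlinarith

end DunfordTaylor

section SquareRoots

variable {ι : Type*} [Fintype ι] [DecidableEq ι]

theorem exists_eigenvector_of_mem_spectrum {M : Matrix ι ι ℂ} {μ : ℂ} (h : μ ∈ spectrum ℂ M) :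
    ∃ x : ι → ℂ, x ≠ 0 ∧ M *ᵥ x = μ • x := by
  rw [spectrum.mem_iff, isUnit_iff_isUnit_det, isUnit_iff_ne_zero, not_not] at h
  obtain ⟨x, hx, h⟩ := exists_mulVec_eq_zero_iff.2 h
  refine ⟨x, hx, ?_⟩
  rw [Algebra.algebraMap_eq_smul_one, sub_mulVec, smul_mulVec, one_mulVec, sub_eq_zero] at h
  exact h.symm

theorem mem_spectrum_of_mulVec_eq {M : Matrix ι ι ℂ} {μ : ℂ} {x : ι → ℂ} (hx : x ≠ 0)
    (h : M *ᵥ x = μ • x) : μ ∈ spectrum ℂ M := by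
  rw [spectrum.mem_iff, isUnit_iff_isUnit_det, isUnit_iff_ne_zero, not_not]
  refine exists_mulVec_eq_zero_iff.1 ⟨x, hx, ?_⟩
  rw [Algebra.algebraMap_eq_smul_one, sub_mulVec, smul_mulVec, one_mulVec, h, sub_self]

omit [DecidableEq ι] in
theorem star_dotProduct_self_eq (x : ι → ℂ) :
    star x ⬝ᵥ x = ((∑ i, Complex.normSq (x i) : ℝ) : ℂ) := by
  simp only [dotProduct, Pi.star_apply, Complex.ofReal_sum, Complex.normSq_eq_conj_mul_self,
    RCLike.star_def]

omit [DecidableEq ι] in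
theorem sum_normSq_pos {x : ι → ℂ} (hx : x ≠ 0) : 0 < ∑ i, Complex.normSq (x i) := by
  obtain ⟨i, hi⟩ := Function.ne_iff.1 hx
  exact Finset.sum_pos' (fun j _ => Complex.normSq_nonneg _)
    ⟨i, Finset.mem_univ _, Complex.normSq_pos.2 hi⟩

theorem StrictlyAccretive.re_pos_of_mem_spectrum {M : Matrix ι ι ℂ} (hM : StrictlyAccretive M)
    {μ : ℂ} (h : μ ∈ spectrum ℂ M) : 0 < μ.re := by
  obtain ⟨x, hx, h⟩ := exists_eigenvector_of_mem_spectrum h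
  have h1 := hM x hx
  rw [h, dotProduct_smul, star_dotProduct_self_eq, smul_eq_mul, Complex.re_mul_ofReal] at h1
  exact pos_of_mul_pos_left h1 (sum_normSq_pos hx).le

open Polynomial in
theorem eq_zero_of_mul_add_mul_eq_zero {A B X : Matrix ι ι ℂ}
    (hA : ∀ μ ∈ spectrum ℂ A, 0 < μ.re) (hB : ∀ μ ∈ spectrum ℂ B, 0 < μ.re)
    (h : A * X + X * B = 0) : X = 0 := by
  rcases subsingleton_or_nontrivial (Matrix ι ι ℂ) with hs | hs
  · exact Subsingleton.elim _ _
  have h1 : X * B = -A * X := by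
    rw [neg_mul, eq_neg_iff_add_eq_zero, add_comm, h]
  have h2 : ∀ p : ℂ[X], X * aeval B p = aeval (-A) p * X := by
    intro p
    induction p using Polynomial.induction_on' with
    | add p q hp hq => rw [map_add, map_add, Matrix.mul_add, Matrix.add_mul, hp, hq]
    | monomial k c =>
      have h3 : X * B ^ k = (-A) ^ k * X := by
        induction k with
        | zero => simp
        | succ k ih =>
          rw [pow_succ, ← Matrix.mul_assoc, ih, Matrix.mul_assoc, h1, ← Matrix.mul_assoc,
            ← pow_succ]
      simp [aeval_monomial, Algebra.algebraMap_eq_smul_one, h3]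
  have h3 := h2 B.charpoly
  rw [aeval_self_charpoly, Matrix.mul_zero] at h3
  have hu : IsUnit (aeval (-A) B.charpoly) := by
    rw [← spectrum.zero_notMem_iff ℂ, spectrum.map_polynomial_aeval_of_nonempty _ _
      (spectrum.nonempty_of_isAlgClosed_of_finiteDimensional ℂ (-A))]
    rintro ⟨z, hz, hz0⟩
    have hzB := hB z (mem_spectrum_iff_isRoot_charpoly.2 hz0)
    rw [← spectrum.neg_eq, Set.mem_neg] at hz
    have := hA _ hz
    rw [Complex.neg_re] at this
    linarith
  exact (hu.mul_right_eq_zero).1 h3.symm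

theorem StrictlyAccretive.eq_of_mul_self_eq {A B : Matrix ι ι ℂ} (hA : StrictlyAccretive A)
    (hB : StrictlyAccretive B) (h : A * A = B * B) : A = B := by
  rw [← sub_eq_zero]
  refine eq_zero_of_mul_add_mul_eq_zero (A := A) (B := B) (fun μ => hA.re_pos_of_mem_spectrum)
    (fun μ => hB.re_pos_of_mem_spectrum) ?_
  rw [Matrix.mul_sub, Matrix.sub_mul, h]
  abel

open scoped Matrix.Norms.Operator in
theorem tendsto_pow_zero_of_spectrum {C : Matrix ι ι ℂ} (hC : ∀ μ ∈ spectrum ℂ C, ‖μ‖ < 1) :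
    Filter.Tendsto (fun k => C ^ k) Filter.atTop (nhds 0) := by
  rcases subsingleton_or_nontrivial (Matrix ι ι ℂ) with hs | hs
  · rw [show (fun k => C ^ k) = fun _ => 0 from Subsingleton.elim _ _]
    exact tendsto_const_nhds
  have hlt : spectralRadius ℂ C < (1 : NNReal) :=
    spectrum.spectralRadius_lt_of_forall_lt C fun z hz => by
      rw [← NNReal.coe_lt_coe]; simpa using hC z hz
  obtain ⟨ρ, h1, h2⟩ := ENNReal.lt_iff_exists_nnreal_btwn.1 hlt
  have hρ : ρ < 1 := by exact_mod_cast h2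
  have hev := (spectrum.pow_nnnorm_pow_one_div_tendsto_nhds_spectralRadius C).eventually_lt_const h1
  refine tendsto_zero_iff_norm_tendsto_zero.2 ?_
  refine squeeze_zero' (Filter.Eventually.of_forall fun k => norm_nonneg _) ?_
    (tendsto_pow_atTop_nhds_zero_of_lt_one ρ.coe_nonneg (by exact_mod_cast hρ))
  filter_upwards [hev, Filter.eventually_gt_atTop 0] with k hk hk0
  have hk' : (k : ℝ) ≠ 0 := by exact_mod_cast hk0.ne'
  have h3 := ENNReal.rpow_le_rpow hk.le (Nat.cast_nonneg k)
  rw [← ENNReal.rpow_mul, one_div, inv_mul_cancel₀ hk', ENNReal.rpow_one,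
    ENNReal.rpow_natCast] at h3
  have h4 : ‖C ^ k‖₊ ≤ ρ ^ k := by exact_mod_cast h3
  exact_mod_cast h4

/-- A strictly accretive matrix has no square root with spectrum in the right half-plane other
than a strictly accretive one. The form of `N + Nᴴ` decreases strictly along the powers of the
Cayley transform of `N`, which tend to zero. -/
theorem strictlyAccretive_of_mul_self {M N : Matrix ι ι ℂ} (hM : StrictlyAccretive M)
    (hNM : N * N = M) (hN : ∀ μ ∈ spectrum ℂ N, 0 < μ.re) : StrictlyAccretive N := by
  set V : (ι → ℂ) → ℝ := fun y => (star y ⬝ᵥ N *ᵥ y).re with hV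
  have hu : IsUnit (N + 1) := by
    have h1 : (-1 : ℂ) ∉ spectrum ℂ N := fun h => by
      have := hN _ h
      norm_num at this
    rw [spectrum.notMem_iff] at h1
    have h2 : N + 1 = -(algebraMap ℂ (Matrix ι ι ℂ) (-1) - N) := by
      rw [map_neg, map_one]; abel
    rw [h2]
    exact h1.neg
  have hdet := (isUnit_iff_isUnit_det _).1 hu
  set C := (N - 1) * (N + 1)⁻¹ with hCdef
  have hCx : ∀ x, C *ᵥ ((N + 1) *ᵥ x) = (N - 1) *ᵥ x := fun x => by
    rw [mulVec_mulVec, hCdef, Matrix.mul_assoc, nonsing_inv_mul _ hdet, Matrix.mul_one]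
  have hsurj : ∀ y, ∃ x, y = (N + 1) *ᵥ x := fun y =>
    ⟨(N + 1)⁻¹ *ᵥ y, by rw [mulVec_mulVec, mul_nonsing_inv _ hdet, one_mulVec]⟩
  have hC : ∀ μ ∈ spectrum ℂ C, ‖μ‖ < 1 := by
    intro μ hμ
    obtain ⟨y, hy, hμy⟩ := exists_eigenvector_of_mem_spectrum hμ
    obtain ⟨x, rfl⟩ := hsurj y
    have hx : x ≠ 0 := fun h => hy (by rw [h, mulVec_zero])
    rw [hCx, sub_mulVec, add_mulVec, one_mulVec] at hμy
    have h1 : (1 - μ) • N *ᵥ x = (1 + μ) • x := by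
      have h2 : N *ᵥ x = μ • (N *ᵥ x + x) + x := by rw [← hμy]; abel
      calc (1 - μ) • N *ᵥ x = N *ᵥ x - μ • N *ᵥ x := by rw [sub_smul, one_smul]
        _ = (μ • (N *ᵥ x + x) + x) - μ • N *ᵥ x := by rw [← h2]
        _ = (1 + μ) • x := by rw [smul_add, add_smul, one_smul]; abel
    have hμ1 : 1 - μ ≠ 0 := fun h => by
      have hμ' : μ = 1 := (sub_eq_zero.1 h).symm
      rw [hμ', sub_self, zero_smul, eq_comm, smul_eq_zero] at h1
      rcases h1 with h1 | h1
      · norm_num at h1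
      · exact hx h1
    have h2 : N *ᵥ x = ((1 + μ) / (1 - μ)) • x := by
      rw [div_eq_inv_mul, mul_smul, ← h1, smul_smul, inv_mul_cancel₀ hμ1, one_smul]
    have h3 := hN _ (mem_spectrum_of_mulVec_eq hx h2)
    have h4 : ((1 + μ) / (1 - μ)).re = (1 - Complex.normSq μ) / Complex.normSq (1 - μ) := by
      rw [Complex.div_re, ← add_div]
      congr 1
      simp [Complex.normSq_apply]
      ring
    rw [h4] at h3
    have h5 := (div_pos_iff_of_pos_right (Complex.normSq_pos.2 hμ1)).1 h3
    rw [Complex.normSq_eq_norm_sq] at h5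
    nlinarith [norm_nonneg μ]
  have hdec : ∀ y, y ≠ 0 → V (C *ᵥ y) < V y := by
    intro y hy
    obtain ⟨x, rfl⟩ := hsurj y
    have hx : x ≠ 0 := fun h => hy (by rw [h, mulVec_zero])
    rw [hCx]
    have h1 := hM x hx
    rw [← hNM, ← mulVec_mulVec] at h1
    have h2 : (star (N *ᵥ x) ⬝ᵥ (N *ᵥ x)).re ≥ 0 := by
      rw [star_dotProduct_self_eq, Complex.ofReal_re]
      exact Finset.sum_nonneg fun i _ => Complex.normSq_nonneg _
    have h3 : V ((N + 1) *ᵥ x) - V ((N - 1) *ᵥ x) =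
        2 * ((star (N *ᵥ x) ⬝ᵥ (N *ᵥ x)).re + (star x ⬝ᵥ N *ᵥ (N *ᵥ x)).re) := by
      rw [hV]
      simp only [add_mulVec, sub_mulVec, one_mulVec, mulVec_add, mulVec_sub, star_add, star_sub,
        add_dotProduct, sub_dotProduct, dotProduct_add, dotProduct_sub, Complex.add_re,
        Complex.sub_re]
      ring
    linarith
  have hdec' : ∀ y, V (C *ᵥ y) ≤ V y := fun y => by
    rcases eq_or_ne y 0 with rfl | hy
    · rw [mulVec_zero]
    · exact (hdec y hy).le
  have hnonneg : ∀ y, 0 ≤ V y := by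
    intro y
    have hanti : Antitone fun k : ℕ => V (C ^ k *ᵥ y) := antitone_nat_of_succ_le fun k => by
      rw [pow_succ', ← mulVec_mulVec]
      exact hdec' _
    have hlim : Filter.Tendsto (fun k : ℕ => V (C ^ k *ᵥ y)) Filter.atTop (nhds 0) := by
      have hcont : Continuous fun D : Matrix ι ι ℂ => V (D *ᵥ y) := by
        rw [hV]
        have h1 : Continuous fun D : Matrix ι ι ℂ => D *ᵥ y :=
          continuous_id.matrix_mulVec continuous_const
        exact Complex.continuous_re.comp (h1.star.dotProduct
          (continuous_const.matrix_mulVec h1))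
      have h2 := (hcont.tendsto 0).comp (tendsto_pow_zero_of_spectrum hC)
      have h3 : V ((0 : Matrix ι ι ℂ) *ᵥ y) = 0 := by rw [hV]; simp
      rw [h3] at h2
      exact h2
    simpa using hanti.le_of_tendsto hlim 0
  exact fun y hy => (hnonneg _).trans_lt (hdec y hy)

theorem StrictlyAccretive.matPow_half {n : ℕ} {M : Matrix (Fin n) (Fin n) ℂ}
    (hM : StrictlyAccretive M) :
    matPow M (1 / 2) * matPow M (1 / 2) = M ∧ StrictlyAccretive (matPow M (1 / 2)) := by
  have h : ∃ q : ℂ × ℝ, IsContour M q.1 q.2 :=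
    exists_isContour M fun μ hμ => hM.re_pos_of_mem_spectrum hμ
  obtain ⟨h1, h2⟩ := h.choose_spec.dunfordTaylor_half
  rw [matPow, dif_pos h]
  exact ⟨h1, strictlyAccretive_of_mul_self hM h1 h2⟩

end SquareRoots

section Fourier

/-- The discrete Fourier matrix. -/
def dftMatrix (p : ℕ) : Matrix (Fin p) (Fin p) ℂ :=
  Matrix.of fun i k => Complex.exp (-(2 * Real.pi * Complex.I * (i : ℕ) * (k : ℕ) / p))

theorem fourierSlice_eq {m n p : ℕ} (A : Tensor m n p) (i : Fin p) :
    fourierSlice A i = ∑ k, dftMatrix p i k • A k := rfl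

theorem star_dftMatrix_apply {p : ℕ} (i k : Fin p) : star (dftMatrix p i k) =
    Complex.exp (2 * Real.pi * Complex.I * (i : ℕ) * (k : ℕ) / p) := by
  rw [dftMatrix, Matrix.of_apply, RCLike.star_def, ← Complex.exp_conj]
  congr 1
  simp only [map_neg, map_div₀, map_mul, Complex.conj_ofReal, Complex.conj_I, map_natCast,
    map_ofNat]
  ring

theorem ofFourierSlices_eq {m n p : ℕ} (M : Fin p → Matrix (Fin m) (Fin n) ℂ) (k : Fin p) :
    ofFourierSlices M k = (p : ℂ)⁻¹ • ∑ i, star (dftMatrix p i k) • M i := by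
  simp only [star_dftMatrix_apply]
  rfl

variable {p : ℕ} [NeZero p]

variable (p) in
theorem exists_dftMatrix_eq_pow : ∃ ζ : ℂ, IsPrimitiveRoot ζ p ∧ star ζ = ζ⁻¹ ∧
    ∀ i k, dftMatrix p i k = (ζ ^ (i : ℕ)) ^ (k : ℕ) := by
  refine ⟨(Complex.exp (2 * Real.pi * Complex.I / p))⁻¹,
    (Complex.isPrimitiveRoot_exp p (NeZero.ne p)).inv, ?_, fun i k => ?_⟩
  · rw [← Complex.exp_neg, RCLike.star_def, ← Complex.exp_conj, ← Complex.exp_neg]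
    congr 1
    simp only [map_neg, map_div₀, map_mul, Complex.conj_ofReal, Complex.conj_I, map_natCast,
      map_ofNat]
    ring
  · rw [← Complex.exp_neg, ← Complex.exp_nat_mul, ← Complex.exp_nat_mul, dftMatrix,
      Matrix.of_apply]
    congr 1
    ring

theorem dftMatrix_add (i k l : Fin p) :
    dftMatrix p i (k + l) = dftMatrix p i k * dftMatrix p i l := by
  obtain ⟨ζ, hprim, -, h⟩ := exists_dftMatrix_eq_pow p
  have h1 : (ζ ^ (i : ℕ)) ^ p = 1 := by
    rw [← pow_mul, mul_comm, pow_mul, hprim.pow_eq_one, one_pow]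
  rw [h, h, h, ← pow_add, Fin.val_add, ← pow_eq_pow_mod _ h1]

theorem dftMatrix_mul_conjTranspose : dftMatrix p * (dftMatrix p)ᴴ = (p : ℂ) • 1 := by
  ext i j
  obtain ⟨ζ, hprim, hstar, h⟩ := exists_dftMatrix_eq_pow p
  have hζ0 : ζ ≠ 0 := hprim.ne_zero (NeZero.ne p)
  have hterm : (dftMatrix p * (dftMatrix p)ᴴ) i j =
      ∑ k ∈ Finset.range p, (ζ ^ (i : ℕ) * (ζ ^ (j : ℕ))⁻¹) ^ k := by
    rw [Matrix.mul_apply, ← Fin.sum_univ_eq_sum_range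
      (fun k => (ζ ^ (i : ℕ) * (ζ ^ (j : ℕ))⁻¹) ^ k)]
    refine Finset.sum_congr rfl fun k _ => ?_
    rw [conjTranspose_apply, h, h, star_pow, star_pow, hstar, inv_pow, mul_pow]
  rw [hterm, Matrix.smul_apply, smul_eq_mul]
  rcases eq_or_ne i j with rfl | hij
  · rw [mul_inv_cancel₀ (pow_ne_zero _ hζ0)]
    simp
  · have hne : ζ ^ (i : ℕ) * (ζ ^ (j : ℕ))⁻¹ ≠ 1 := fun h => by
      rw [← div_eq_mul_inv, div_eq_one_iff_eq (pow_ne_zero _ hζ0)] at h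
      exact hij (Fin.ext (hprim.pow_inj i.isLt j.isLt h))
    rw [geom_sum_eq hne, mul_pow, inv_pow, ← pow_mul, ← pow_mul, mul_comm (i : ℕ),
      mul_comm (j : ℕ), pow_mul, pow_mul, hprim.pow_eq_one]
    simp [Matrix.one_apply_ne hij]

theorem conjTranspose_mul_dftMatrix : (dftMatrix p)ᴴ * dftMatrix p = (p : ℂ) • 1 := by
  have hp : (p : ℂ) ≠ 0 := NeZero.ne _
  have h : dftMatrix p * ((p : ℂ)⁻¹ • (dftMatrix p)ᴴ) = 1 := by
    rw [Matrix.mul_smul, dftMatrix_mul_conjTranspose, smul_smul, inv_mul_cancel₀ hp, one_smul]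
  rw [mul_eq_one_comm, Matrix.smul_mul] at h
  rw [← h, smul_smul, mul_inv_cancel₀ hp, one_smul]

variable {m n s : ℕ}

theorem fourierSlice_ofFourierSlices (M : Fin p → Matrix (Fin m) (Fin n) ℂ) (i : Fin p) :
    fourierSlice (ofFourierSlices M) i = M i := by
  have hp : (p : ℂ) ≠ 0 := NeZero.ne _
  have h : ∀ j, ∑ k, dftMatrix p i k * star (dftMatrix p j k) =
      (p : ℂ) * (1 : Matrix (Fin p) (Fin p) ℂ) i j := fun j => by
    have := congrFun (congrFun (dftMatrix_mul_conjTranspose (p := p)) i) j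
    simpa [Matrix.mul_apply] using this
  rw [fourierSlice_eq]
  simp only [ofFourierSlices_eq, Finset.smul_sum, smul_smul, mul_left_comm _ (p : ℂ)⁻¹]
  rw [Finset.sum_comm]
  simp only [← Finset.sum_smul, ← Finset.mul_sum, h, inv_mul_cancel_left₀ hp, Matrix.one_apply,
    ite_smul, one_smul, zero_smul]
  simp

theorem ofFourierSlices_fourierSlice (A : Tensor m n p) :
    ofFourierSlices (fourierSlice A) = A := by
  have hp : (p : ℂ) ≠ 0 := NeZero.ne _
  funext k
  have h : ∀ l, ∑ i, star (dftMatrix p i k) * dftMatrix p i l =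
      (p : ℂ) * (1 : Matrix (Fin p) (Fin p) ℂ) k l := fun l => by
    have := congrFun (congrFun (conjTranspose_mul_dftMatrix (p := p)) k) l
    simpa [Matrix.mul_apply] using this
  rw [ofFourierSlices_eq]
  simp only [fourierSlice_eq, Finset.smul_sum, smul_smul]
  rw [Finset.sum_comm]
  simp only [← Finset.sum_smul, ← Finset.mul_sum, h, inv_mul_cancel_left₀ hp, Matrix.one_apply,
    ite_smul, one_smul, zero_smul]
  simp

omit [NeZero p] in
theorem tMul_apply (A : Tensor m n p) (B : Tensor n s p) (k : Fin p) :
    tMul A B k = ∑ l, A (k - l) * B l := by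
  ext a b
  rw [Matrix.sum_apply]
  simp only [tMul, foldT, bcirc, unfoldT, Matrix.of_apply, Matrix.mul_apply,
    Fintype.sum_prod_type]

theorem fourierSlice_tMul (A : Tensor m n p) (B : Tensor n s p) (i : Fin p) :
    fourierSlice (tMul A B) i = fourierSlice A i * fourierSlice B i := by
  rw [fourierSlice_eq, fourierSlice_eq, fourierSlice_eq]
  simp only [tMul_apply, Finset.smul_sum]
  rw [Finset.sum_comm, Matrix.mul_sum]
  refine Finset.sum_congr rfl fun l _ => ?_
  rw [← Equiv.sum_comp (Equiv.addRight l), Matrix.sum_mul]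
  refine Finset.sum_congr rfl fun k _ => ?_
  rw [Equiv.coe_addRight, add_sub_cancel_right, dftMatrix_add, Matrix.smul_mul, Matrix.mul_smul,
    smul_smul]

theorem frobInner_eq_fourierSlice (X Y : Tensor m n p) :
    frobInner X Y = (p : ℂ)⁻¹ *
      ∑ i, ∑ a, ∑ b, star (fourierSlice X i a b) * fourierSlice Y i a b := by
  have hp : (p : ℂ) ≠ 0 := NeZero.ne _
  have key : ∀ u v : Fin p → ℂ, ∑ i, star ((dftMatrix p *ᵥ u) i) * (dftMatrix p *ᵥ v) i =
      p * ∑ k, star (u k) * v k := fun u v => by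
    have h1 : ∑ i, star ((dftMatrix p *ᵥ u) i) * (dftMatrix p *ᵥ v) i =
        star (dftMatrix p *ᵥ u) ⬝ᵥ (dftMatrix p *ᵥ v) := rfl
    rw [h1, star_mulVec, ← dotProduct_mulVec, mulVec_mulVec, conjTranspose_mul_dftMatrix,
      smul_mulVec, one_mulVec, dotProduct_smul]
    rfl
  have hs : ∀ (Z : Tensor m n p) i a b,
      fourierSlice Z i a b = (dftMatrix p *ᵥ fun k => Z k a b) i := fun Z i a b => by
    rw [fourierSlice_eq, Matrix.sum_apply]
    rfl
  have h2 : ∑ i, ∑ a, ∑ b, star (fourierSlice X i a b) * fourierSlice Y i a b =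
      ∑ a, ∑ b, ∑ i, star (fourierSlice X i a b) * fourierSlice Y i a b := by
    rw [Finset.sum_comm]
    exact Finset.sum_congr rfl fun a _ => Finset.sum_comm
  rw [h2]
  simp only [hs, key, ← Finset.mul_sum]
  rw [inv_mul_cancel_left₀ hp, frobInner, Finset.sum_comm]
  exact Finset.sum_congr rfl fun a _ => Finset.sum_comm

theorem frobInner_tMul_self (A : Tensor n n p) (X : Tensor n 1 p) :
    frobInner X (tMul A X) = (p : ℂ)⁻¹ * ∑ i, star (fun a => fourierSlice X i a 0) ⬝ᵥ
      fourierSlice A i *ᵥ fun a => fourierSlice X i a 0 := by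
  rw [frobInner_eq_fourierSlice]
  congr 1
  refine Finset.sum_congr rfl fun i _ => Finset.sum_congr rfl fun a _ => ?_
  rw [Fin.sum_univ_one, fourierSlice_tMul]
  rfl

theorem mem_accretive_iff_fourierSlice {A : Tensor n n p} :
    A ∈ accretive n p ↔ ∀ i, StrictlyAccretive (fourierSlice A i) := by
  have hp : (0 : ℝ) < (p : ℝ)⁻¹ := inv_pos.2 (Nat.cast_pos.2 (NeZero.pos p))
  have hre : ∀ z : ℂ, ((p : ℂ)⁻¹ * z).re = (p : ℝ)⁻¹ * z.re := fun z => by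
    rw [← Complex.ofReal_natCast, ← Complex.ofReal_inv, Complex.re_ofReal_mul]
  constructor
  · intro hA i x hx
    set X : Tensor n 1 p := ofFourierSlices fun j => Matrix.of fun a _ => if j = i then x a else 0
      with hX
    have hXs : ∀ j, fourierSlice X j = Matrix.of fun a _ => if j = i then x a else 0 :=
      fun j => fourierSlice_ofFourierSlices _ j
    have hX0 : X ≠ 0 := fun h => by
      obtain ⟨a, ha⟩ := Function.ne_iff.1 hx
      have h1 := congrFun (congrFun (hXs i) a) 0
      rw [h, fourierSlice_eq] at h1
      simp only [Pi.zero_apply, smul_zero, Finset.sum_const_zero, Matrix.zero_apply,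
        Matrix.of_apply, if_true] at h1
      exact ha h1.symm
    have h := hA X hX0
    rw [frobInner_tMul_self, hre] at h
    have h2 := pos_of_mul_pos_right h hp.le
    rw [Finset.sum_eq_single i] at h2
    · simpa [hXs] using h2
    · intro j _ hj
      have : (fun a => fourierSlice X j a 0) = 0 := by
        funext a
        rw [hXs]
        simp [hj]
      rw [this]
      simp
    · simp
  · intro hA X hX
    rw [frobInner_tMul_self, hre, Complex.re_sum]
    refine mul_pos hp ?_
    have hne : ∃ i, (fun a => fourierSlice X i a 0) ≠ 0 := by
      by_contra! h
      apply hX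
      rw [← ofFourierSlices_fourierSlice X]
      have h0 : fourierSlice X = fun _ => 0 := by
        funext i
        ext a b
        rw [Subsingleton.elim b 0]
        exact congrFun (h i) a
      funext k
      rw [h0, ofFourierSlices_eq]
      simp
    obtain ⟨i, hi⟩ := hne
    refine Finset.sum_pos' (fun j _ => ?_) ⟨i, Finset.mem_univ _, hA i _ hi⟩
    rcases eq_or_ne (fun a => fourierSlice X j a 0) 0 with h | h
    · rw [h]; simp
    · exact (hA j _ h).le

end Fourier

section BlockCirculant

variable {n p : ℕ}

theorem mem_accretive_iff_bcirc {A : Tensor n n p} :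
    A ∈ accretive n p ↔ StrictlyAccretive (bcirc A) := by
  have key : ∀ X : Tensor n 1 p, frobInner X (tMul A X) =
      star (fun y : Fin p × Fin n => X y.1 y.2 0) ⬝ᵥ
        bcirc A *ᵥ fun y : Fin p × Fin n => X y.1 y.2 0 := by
    intro X
    simp only [frobInner, dotProduct, Fintype.sum_prod_type, Fin.sum_univ_one]
    rfl
  constructor
  · intro hA x hx
    have h := hA (fun k => Matrix.of fun a _ => x (k, a)) fun h => hx (by
      funext y
      exact congrFun (congrFun (congrFun h y.1) y.2) 0)
    rwa [key] at h
  · intro hA X hX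
    rw [key]
    refine hA _ fun h => hX ?_
    funext k
    ext a b
    rw [Subsingleton.elim b 0]
    exact congrFun h (k, a)

theorem bcirc_tMul (A B : Tensor n n p) : bcirc (tMul A B) = bcirc A * bcirc B := by
  rcases p with _ | p
  · ext x
    exact x.1.elim0
  ext ⟨x, a⟩ ⟨y, b⟩
  simp only [bcirc, Matrix.of_apply, Matrix.mul_apply, Fintype.sum_prod_type, tMul_apply,
    Matrix.sum_apply]
  rw [← Equiv.sum_comp (Equiv.subRight y)]
  refine Finset.sum_congr rfl fun l _ => Finset.sum_congr rfl fun c _ => ?_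
  rw [Equiv.subRight_apply, sub_sub_sub_cancel_right]

theorem bcirc_injective : Function.Injective (bcirc : Tensor n n p → _) := by
  intro A B h
  rcases p with _ | p
  · exact Subsingleton.elim _ _
  funext k
  ext a b
  simpa [bcirc] using congrFun (congrFun h (k, a)) (0, b)

theorem tPow_half_spec {A : Tensor n n p} (hA : A ∈ accretive n p) :
    tPow A (1 / 2) ∈ accretive n p ∧ tMul (tPow A (1 / 2)) (tPow A (1 / 2)) = A := by
  rcases p with _ | p
  · exact ⟨fun X hX => absurd (Subsingleton.elim X 0) hX, Subsingleton.elim _ _⟩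
  have hs : ∀ i, fourierSlice (tPow A (1 / 2)) i = matPow (fourierSlice A i) (1 / 2) :=
    fun i => fourierSlice_ofFourierSlices _ i
  rw [mem_accretive_iff_fourierSlice] at hA ⊢
  refine ⟨fun i => ?_, ?_⟩
  · rw [hs]
    exact (hA i).matPow_half.2
  · rw [← ofFourierSlices_fourierSlice (tMul _ _), ← ofFourierSlices_fourierSlice A]
    congr 1
    funext i
    rw [fourierSlice_tMul, ofFourierSlices_fourierSlice, hs, (hA i).matPow_half.1]

end BlockCirculant

section CanonicalPhases

variable {n p : ℕ} {A : Tensor n n p}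

theorem isSectorial_of_mem_accretive (hA : A ∈ accretive n p) : IsSectorial A := by
  rintro ⟨X, hX, h⟩
  have hX0 : X ≠ 0 := fun h0 => by
    rw [h0] at hX
    simp [frobNorm, frobInner] at hX
  have := hA X hX0
  rw [← h] at this
  simp at this

theorem mem_Ioo_of_cos_pos {x : ℝ} (hx : x ∈ Set.Ioc (-Real.pi) Real.pi) (h : 0 < Real.cos x) :
    x ∈ Set.Ioo (-(Real.pi / 2)) (Real.pi / 2) := by
  have hpi := Real.pi_pos
  constructor
  · by_contra! h1
    have := Real.cos_nonpos_of_pi_div_two_le_of_le (x := -x) (by linarith) (by linarith [hx.1])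
    rw [Real.cos_neg] at this
    linarith
  · by_contra! h1
    have := Real.cos_nonpos_of_pi_div_two_le_of_le (x := x) h1 (by linarith [hx.2])
    linarith

theorem isCanonicalPhaseVector_iff (hA : A ∈ accretive n p) {φ : Fin (n * p) → ℝ} :
    IsCanonicalPhaseVector A φ ↔ IsPhaseVector (bcirc A) φ := by
  have hacc := mem_accretive_iff_bcirc.1 hA
  constructor
  · intro h
    obtain ⟨T, e, hT, hdec⟩ := h.decomposition
    have hdec' : bcirc A = Tᴴ * phaseDiag (φ ∘ e) * T := hdec
    have hdet := (isUnit_iff_isUnit_det T).1 hT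
    have hTi := mul_nonsing_inv T hdet
    have hiT := nonsing_inv_mul T hdet
    have hD : StrictlyAccretive (phaseDiag (φ ∘ e)) := by
      have h1 : (T⁻¹)ᴴ * bcirc A * T⁻¹ = phaseDiag (φ ∘ e) := by
        have h2 : (T⁻¹)ᴴ * Tᴴ = 1 := by rw [← conjTranspose_mul, hTi, conjTranspose_one]
        calc (T⁻¹)ᴴ * bcirc A * T⁻¹ = ((T⁻¹)ᴴ * Tᴴ) * phaseDiag (φ ∘ e) * (T * T⁻¹) := by
              rw [hdec']; simp only [Matrix.mul_assoc]
          _ = _ := by rw [h2, hTi, Matrix.one_mul, Matrix.mul_one]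
      rw [← h1]
      exact hacc.congruence (mulVec_eq_zero_of_leftInverse hTi)
    have hcos : ∀ x, 0 < Real.cos (φ (e x)) := fun x => by
      have h1 := hD (Pi.single x 1) (by simp)
      rw [star_dotProduct_phaseDiag, Finset.sum_eq_single x] at h1
      · simpa [Complex.exp_ofReal_mul_I_re] using h1
      · intro y _ hy
        simp [hy]
      · simp
    refine ⟨h.antitone, fun k => mem_Ioo_of_cos_pos (h.mem_Ioc k) ?_, T.submatrix e.symm id,
      T⁻¹.submatrix id e.symm, ?_, ?_, ?_⟩
    · simpa using hcos (e.symm k)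
    · rw [← submatrix_mul _ _ _ _ _ Function.bijective_id, hTi, submatrix_one_equiv]
    · rw [submatrix_mul_equiv, hiT, submatrix_id_id]
    · have h1 := phaseDiag_comp_equiv e (φ ∘ e) T
      rw [Function.comp_assoc, e.self_comp_symm, Function.comp_id] at h1
      rw [hdec', h1]
  · intro h
    obtain ⟨T, R, hTR, hRT, hdec⟩ := h.decomposition
    have hpi := Real.pi_pos
    let e : Fin p × Fin n ≃ Fin (n * p) := Fintype.equivFinOfCardEq (by simp [mul_comm])
    refine ⟨isSectorial_of_mem_accretive hA, h.antitone, fun k => ?_, fun k l => ?_,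
      T.submatrix e id, e, ?_, ?_⟩
    · have := h.mem_Ioo k
      exact ⟨by linarith [this.1], by linarith [this.2]⟩
    · linarith [(h.mem_Ioo k).2, (h.mem_Ioo l).1]
    · refine IsUnit.of_mul_eq_one (R.submatrix id e) ?_
      rw [← submatrix_mul _ _ _ _ _ Function.bijective_id, hTR, submatrix_one_equiv]
    · have h1 := phaseDiag_comp_equiv e (φ ∘ e) (T.submatrix e id)
      rw [Function.comp_assoc, e.self_comp_symm, Function.comp_id, submatrix_submatrix,
        e.self_comp_symm, Function.comp_id, submatrix_id_id] at h1
      rw [hdec, h1]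
      rfl

theorem existsUnique_isCanonicalPhaseVector (hA : A ∈ accretive n p) :
    ∃! φ, IsCanonicalPhaseVector A φ := by
  obtain ⟨φ, hφ⟩ := (mem_accretive_iff_bcirc.1 hA).exists_isPhaseVector (N := n * p)
    (by simp [mul_comm])
  refine ⟨φ, (isCanonicalPhaseVector_iff hA).2 hφ, fun θ hθ => ?_⟩
  exact ((isCanonicalPhaseVector_iff hA).1 hθ).unique hφ

theorem isPhaseVector_phases (hA : A ∈ accretive n p) : IsPhaseVector (bcirc A) (phases A) := by
  have h := (existsUnique_isCanonicalPhaseVector hA).exists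
  rw [phases, dif_pos h]
  exact (isCanonicalPhaseVector_iff hA).1 h.choose_spec

end CanonicalPhases

section Majorization

variable {N : ℕ}

theorem decreasing_eq_self {x : Fin N → ℝ} (hx : Antitone x) : decreasing x = x := by
  have h := Tuple.unique_antitone (f := x) (σ := Fin.revPerm.trans (Tuple.sort x))
    (τ := Equiv.refl _) (fun i j hij => Tuple.monotone_sort x (Fin.rev_le_rev.2 hij)) hx
  exact h

theorem sum_filter_val_lt (f : Fin N → ℝ) (k : ℕ) :
    ∑ i with i.val < k, f i = ∑ i : Fin (min k N), f (i.castLE (min_le_right k N)) := by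
  refine (Finset.sum_bij (fun i _ => i.castLE (min_le_right k N)) (fun i _ => ?_)
    (fun i _ j _ h => Fin.castLE_injective _ h) (fun i hi => ?_) (fun _ _ => rfl)).symm
  · simp only [Finset.mem_filter, Finset.mem_univ, true_and, Fin.val_castLE]
    exact i.isLt.trans_le (min_le_left _ _)
  · simp only [Finset.mem_filter, Finset.mem_univ, true_and] at hi
    exact ⟨⟨i, lt_min hi i.isLt⟩, Finset.mem_univ _, rfl⟩

theorem majorized_two_smul_phases {ι : Type*} [Fintype ι] [DecidableEq ι] {S : Matrix ι ι ℂ}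
    {ψ φ : Fin N → ℝ} (hψ : IsPhaseVector S ψ) (hφ : IsPhaseVector (S * S) φ) :
    Majorized ((2 : ℝ) • ψ) φ := by
  have hanti : Antitone ((2 : ℝ) • ψ) := fun i j hij =>
    mul_le_mul_of_nonneg_left (hψ.antitone hij) two_pos.le
  refine ⟨fun k => ?_, ?_⟩
  · rw [decreasing_eq_self hanti, decreasing_eq_self hφ.antitone, sum_filter_val_lt,
      sum_filter_val_lt]
    have h := two_mul_sum_phases_le (min_le_right k N) hφ.strictlyAccretive hψ hφ
    rw [Finset.mul_sum] at h
    exact h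
  · have h := two_mul_sum_phases_eq hφ.strictlyAccretive hψ hφ
    rw [Finset.mul_sum] at h
    exact h

end Majorization

end TProduct

end

theorem mainTheorem7 (n p : ℕ) (A : TProduct.Tensor n n p) (hA : A ∈ TProduct.accretive n p) :
    -- `A^{1/2}` is the square root of `A` in the class of strictly accretive tensors
    (TProduct.tPow A (1 / 2) ∈ TProduct.accretive n p ∧
      TProduct.tMul (TProduct.tPow A (1 / 2)) (TProduct.tPow A (1 / 2)) = A ∧
      ∀ S ∈ TProduct.accretive n p, TProduct.tMul S S = A → S = TProduct.tPow A (1 / 2)) ∧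
    -- both canonical phase vectors exist and are unique
    (∃! φ, TProduct.IsCanonicalPhaseVector A φ) ∧
    (∃! φ, TProduct.IsCanonicalPhaseVector (TProduct.tPow A (1 / 2)) φ) ∧
    TProduct.Majorized ((2 : ℝ) • TProduct.phases (TProduct.tPow A (1 / 2)))
      (TProduct.phases A) := by
  obtain ⟨hR, hRR⟩ := TProduct.tPow_half_spec hA
  refine ⟨⟨hR, hRR, fun S hS hSS => TProduct.bcirc_injective ?_⟩,
    TProduct.existsUnique_isCanonicalPhaseVector hA,
    TProduct.existsUnique_isCanonicalPhaseVector hR,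
    TProduct.majorized_two_smul_phases (TProduct.isPhaseVector_phases hR) ?_⟩
  · refine (TProduct.mem_accretive_iff_bcirc.1 hS).eq_of_mul_self_eq
      (TProduct.mem_accretive_iff_bcirc.1 hR) ?_
    rw [← TProduct.bcirc_tMul, ← TProduct.bcirc_tMul, hSS, hRR]
  · rw [← TProduct.bcirc_tMul, hRR]
    exact TProduct.isPhaseVector_phases hA
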